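/- Let $d\ge 0$ and let $w$ be a non-trivial element of the free group $F_d$ on $x_1,\dots,x_d$. There is a constant $c=c(w)$ with the following property. Let $G$ range over all finite classical groups of rank $r\ge 1$ over $\mathbb F_q$ ($q$ any prime power, $r$ any positive integer), and let $g_1,\dots,g_d\in G$ be chosen uniformly and independently. Then $$\Pr\bigl[\,|\mathbf C_G(w(g_1,\dots,g_d))|\le q^{cr}\,\bigr]\longrightarrow 1\qquad\text{as } |G|\to\infty ;$$ that is, for every $\varepsilon>0$ there is an $N$ such that for all such $q$, $r$ and $G$ with $|G|\ge N$ this probability differs from $1$ by less than $\varepsilon$. Here a classical group of rank $r$ over $\mathbb F_q$ is a quotient $H/Z$, where $Z$ is a central subgroup of $H$ and, for some finite-dimensional vector space $V$, one of the following holds: (a) (linear) $V$ is over $\mathbb F_q$, $\dim V=r+1$, and $\mathrm{SL}(V)\le H\le \mathrm{GL}(V)$; (b) (unitary) $V$ is over $\mathbb F_{q^2}$, $\dim V=r+1$, $V$ carries a non-degenerate Hermitian form with respect to $a\mapsto a^q$, and $\mathrm{SU}(V)\le H\le \mathrm U(V)$; (c) (symplectic) $V$ is over $\mathbb F_q$,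 $\dim V=2r$, $V$ carries a non-degenerate alternating form, and $\mathrm{Sp}(V)\le H\le \mathrm{CSp}(V)$, where $\mathrm{CSp}(V)$ is the group of linear automorphisms that preserve the form up to a non-zero scalar; (d) (orthogonal) $V$ is over $\mathbb F_q$, $\dim V\in\{2r,2r+1\}$, $V$ carries a quadratic form $Q$ that has no non-zero zero in the radical of its polar form, and $\Omega(V)\le H\le \mathrm O(V)$, where $\Omega(V)=[\mathrm O(V),\mathrm O(V)]$. (In particular every $H$ with $\mathrm{SO}(V)\le H\le\mathrm O(V)$ is allowed.) -/

import Mathlib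

namespace ClassicalGroups

section Forms

variable {K V : Type*} [Field K] [AddCommGroup V] [Module K V]

/-- The special linear group `SL(V)`, as a subgroup of `GL(V)`. -/
noncomputable def specialLinear (K V : Type*) [Field K] [AddCommGroup V] [Module K V] :
    Subgroup (V ≃ₗ[K] V) :=
  (LinearEquiv.det : (V ≃ₗ[K] V) →* Kˣ).ker

/-- The isometry group of a sesquilinear form: the unitary group `U(V)` if the form is
Hermitian, the symplectic group `Sp(V)` if it is alternating bilinear. -/
def isometries {σ : K →+* K} (B : V →ₛₗ[σ] V →ₗ[K] K) : Subgroup (V ≃ₗ[K] V) where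
  carrier := {g | ∀ x y, B (g x) (g y) = B x y}
  one_mem' := fun _ _ => rfl
  mul_mem' := by
    intro a b ha hb x y
    rw [LinearEquiv.mul_apply, LinearEquiv.mul_apply, ha, hb]
  inv_mem' := by
    intro a ha x y
    have h := ha (a⁻¹ x) (a⁻¹ y)
    rw [← LinearEquiv.mul_apply, ← LinearEquiv.mul_apply, mul_inv_cancel] at h
    exact h.symm

/-- The group of similitudes of a bilinear form (maps preserving the form up to a non-zero
multiplier): the conformal symplectic group `CSp(V)` if the form is alternating. -/
def similitudes (B : LinearMap.BilinForm K V) : Subgroup (V ≃ₗ[K] V) where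
  carrier := {g | ∃ μ : Kˣ, ∀ x y, B (g x) (g y) = μ * B x y}
  one_mem' := ⟨1, fun x y => by simp⟩
  mul_mem' := by
    rintro a b ⟨μ, ha⟩ ⟨ν, hb⟩
    refine ⟨μ * ν, fun x y => ?_⟩
    rw [LinearEquiv.mul_apply, LinearEquiv.mul_apply, ha, hb, Units.val_mul, mul_assoc]
  inv_mem' := by
    rintro a ⟨μ, ha⟩
    refine ⟨μ⁻¹, fun x y => ?_⟩
    have h := ha (a⁻¹ x) (a⁻¹ y)
    rw [← LinearEquiv.mul_apply, ← LinearEquiv.mul_apply, mul_inv_cancel] at h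
    change B x y = _ at h
    rw [h, Units.inv_mul_cancel_left]

/-- The orthogonal group `O(V, Q)` of a quadratic form. -/
def orthogonal (Q : QuadraticForm K V) : Subgroup (V ≃ₗ[K] V) where
  carrier := {g | ∀ x, Q (g x) = Q x}
  one_mem' := fun _ => rfl
  mul_mem' := by
    intro a b ha hb x
    rw [LinearEquiv.mul_apply, ha, hb]
  inv_mem' := by
    intro a ha x
    have h := ha (a⁻¹ x)
    rw [← LinearEquiv.mul_apply, mul_inv_cancel] at h
    exact h.symm

/-- Non-degeneracy of a quadratic form, in the sense that is right in every characteristic: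
no non-zero singular vector lies in the radical of the polar form. In odd characteristic, or in
even dimension over a finite field, this says that the polar form is non-degenerate; in odd
dimension over a finite field of characteristic 2 the radical is an anisotropic line. -/
def NondegenerateQuadratic (Q : QuadraticForm K V) : Prop :=
  ∀ x, Q x = 0 → (∀ y, QuadraticMap.polar Q x y = 0) → x = 0

/-- `SL(V) ≤ H ≤ GL(V)` with `V` of dimension `r + 1` over the field `K` of `q` elements. -/
def IsLinearType (q r : ℕ) (H : Subgroup (V ≃ₗ[K] V)) : Prop :=
  Nat.card K = q ∧ Module.finrank K V = r + 1 ∧ specialLinear K V ≤ H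

/-- `SU(V) ≤ H ≤ U(V)` for a non-degenerate Hermitian form, with respect to `x ↦ x ^ q`, on a
space `V` of dimension `r + 1` over the field `K` of `q ^ 2` elements. -/
def IsUnitaryType (q r : ℕ) (H : Subgroup (V ≃ₗ[K] V)) : Prop :=
  Nat.card K = q ^ 2 ∧ Module.finrank K V = r + 1 ∧
    ∃ σ : K →+* K, (∀ a, σ a = a ^ q) ∧
      ∃ B : V →ₛₗ[σ] V →ₗ[K] K, (∀ x y, B y x = σ (B x y)) ∧ B.Nondegenerate ∧
        isometries B ⊓ specialLinear K V ≤ H ∧ H ≤ isometries B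

/-- `Sp(V) ≤ H ≤ CSp(V)` for a non-degenerate alternating form on a space `V` of dimension
`2 r` over the field `K` of `q` elements. -/
def IsSymplecticType (q r : ℕ) (H : Subgroup (V ≃ₗ[K] V)) : Prop :=
  Nat.card K = q ∧ Module.finrank K V = 2 * r ∧
    ∃ B : LinearMap.BilinForm K V, B.IsAlt ∧ B.Nondegenerate ∧
      isometries B ≤ H ∧ H ≤ similitudes B

/-- `Ω(V, Q) ≤ H ≤ O(V, Q)`, where `Ω(V, Q)` is the commutator subgroup of `O(V, Q)`, for a
non-degenerate quadratic form `Q` (of any isometry type) on a space `V` of dimension `2 r` or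
`2 r + 1` over the field `K` of `q` elements. As `SO(V, Q)` contains `Ω(V, Q)`, under every
convention on `SO` in characteristic 2, this covers all `H` with `SO(V, Q) ≤ H ≤ O(V, Q)`. -/
def IsOrthogonalType (q r : ℕ) (H : Subgroup (V ≃ₗ[K] V)) : Prop :=
  Nat.card K = q ∧ (Module.finrank K V = 2 * r ∨ Module.finrank K V = 2 * r + 1) ∧
    ∃ Q : QuadraticForm K V, NondegenerateQuadratic Q ∧
      ⁅orthogonal Q, orthogonal Q⁆ ≤ H ∧ H ≤ orthogonal Q

end Forms

/-- `G` is a classical group of rank `r` over the field with `q` elements: the quotient of a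
linear, unitary, symplectic or orthogonal group `H` by a central subgroup, that is, the image
of a surjective homomorphism from `H` whose kernel is central. -/
def IsClassicalGroup (q r : ℕ) (G : Type*) [Group G] : Prop :=
  ∃ (K : Type) (_ : Field K) (_ : Finite K) (n : ℕ)
    (H : Subgroup ((Fin n → K) ≃ₗ[K] (Fin n → K))) (π : H →* G),
    (IsLinearType q r H ∨ IsUnitaryType q r H ∨ IsSymplecticType q r H ∨
      IsOrthogonalType q r H) ∧
    Function.Surjective π ∧ π.ker ≤ Subgroup.center H

/-- The probability that `w(g₁, …, g_d)` satisfies `P`, for `g₁, …, g_d` chosen uniformly and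
independently from the finite group `G`. -/
noncomputable def wordProb {d : ℕ} (w : FreeGroup (Fin d)) (G : Type*) [Group G]
    (P : G → Prop) : ℝ :=
  (Nat.card {g : Fin d → G // P (FreeGroup.lift g w)} : ℝ) / (Nat.card G : ℝ) ^ d

end ClassicalGroups

/-! Write κ for the size of the field of V, n for dim V, and x for the value of w at a random tuple
of H. Up to conjugacy w is a cyclically reduced word of length l ≥ 1. The centralizer of x lies in
its linear commutant, so it suffices to bound the dimension of the latter by a constant multiple of
n with high probability.

Linear algebra (`finrank_commutant_le`): if dim ker ψ(x) ≤ m deg ψ for all monic ψ of degree at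
least D, the commutant has dimension at most mn plus an error depending only on m, D and κ. An
invariant subspace is enlarged by one cyclic subspace at a time; a commuting map that vanishes on
the old subspace and at the new generator vanishes on the larger one.

Probability (`card_large_kernel_mul_le`): if ψ(x)v = 0 then, among the vectors met while applying
the letters of w over and over to v, the one at time l deg ψ depends linearly on earlier ones. As
long as no dependence has occurred, the next letter may be multiplied by a random element s of H
fixing all earlier vectors. Such s move the current vector over an orbit of size at least κ^(n - O(l
deg ψ)), so a dependence has probability κ^(O(l deg ψ) - n). Summing over v bounds the mean size of
ker ψ(x), and Markov's inequality beats the κ^(deg ψ) choices of ψ by enough to sum over all degrees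
from D on: the exceptional probability is at most κ^(-D) (`card_exists_large_kernel_mul_le`).

The large orbits come from transvections for SL and Sp, and from Eichler transformations for SU and
Ω.

If κ is large, D = 1 makes both κ^(-D) and the error term harmless. If κ is bounded, D is fixed
large and n must grow with |H|, so it absorbs the error. Finally, passing to a quotient of H does
not increase centralizers (`card_centralizer_map_le`). -/

namespace ClassicalGroups

/-! ### Bounding the commutant of an endomorphism by kernels of polynomials in it -/

section Commutant

open Polynomial Module

variable {K V : Type*} [Field K] [AddCommGroup V] [Module K V]

/-- The endomorphisms that commute with `x` and vanish on the subspace `A`. -/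
def commutantVanishing (x : End K V) (A : Submodule K V) : Submodule K (End K V) where
  carrier := {c | c * x = x * c ∧ ∀ a ∈ A, c a = 0}
  zero_mem' := by simp
  add_mem' := by
    rintro a b ⟨ha, ha'⟩ ⟨hb, hb'⟩
    refine ⟨by rw [add_mul, mul_add, ha, hb], fun v hv => ?_⟩
    simp [ha' v hv, hb' v hv]
  smul_mem' := by
    rintro k a ⟨ha, ha'⟩
    refine ⟨by rw [smul_mul_assoc, mul_smul_comm, ha], fun v hv => ?_⟩
    simp [ha' v hv]

theorem aeval_apply_mem {x : End K V} {A : Submodule K V} (hA : ∀ a ∈ A, x a ∈ A) (p : K[X])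
    {a : V} (ha : a ∈ A) : aeval x p a ∈ A := by
  induction p using Polynomial.induction_on' with
  | add p q hp hq => simpa using A.add_mem hp hq
  | monomial n c =>
    have : (x ^ n) a ∈ A := by
      induction n with
      | zero => simpa
      | succ n ih => rw [pow_succ']; exact hA _ ih
    simpa [aeval_monomial] using A.smul_mem c this

theorem aeval_apply_commute {x c : End K V} (h : c * x = x * c) (p : K[X]) (v : V) :
    c (aeval x p v) = aeval x p (c v) := by
  have : Commute c (aeval x p) := by
    induction p using Polynomial.induction_on' with
    | add p q hp hq => simpa using hp.add_right hq
    | monomial n k =>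
      rw [aeval_monomial]
      exact (Algebra.commute_algebraMap_right k c).mul_right (Commute.pow_right h n)
  exact LinearMap.congr_fun this.eq v

variable [FiniteDimensional K V]

/-- Adjoining the cyclic subspace of a vector `v` to an invariant subspace. -/
theorem exists_conductor (x : End K V) (A : Submodule K V) (hA : ∀ a ∈ A, x a ∈ A) {v : V}
    (hv : v ∉ A) :
    ∃ (ψ : K[X]) (A' : Submodule K V), ψ.Monic ∧ 0 < ψ.natDegree ∧ aeval x ψ v ∈ A ∧ A ≤ A' ∧
      (∀ a ∈ A', x a ∈ A') ∧ finrank K A + ψ.natDegree ≤ finrank K A' ∧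
      finrank K (commutantVanishing x A) ≤
        finrank K (commutantVanishing x A') + finrank K (LinearMap.ker (aeval x ψ)) := by
  classical
  let L : K[X] →ₗ[K] V := (LinearMap.applyₗ v).comp (aeval x).toLinearMap
  have hL : ∀ p, L p = aeval x p v := fun p => rfl
  -- `B i` is A together with the span of v, ..., x^(i-1) v. It gains a dimension at each step until
  -- x^D v falls into it; this first D is the degree of the minimal polynomial ψ of v modulo A.
  let B : ℕ → Submodule K V := fun i => A ⊔ (degreeLT K i).map L
  have hB : ∀ i, (∀ j < i, (x ^ j) v ∉ B j) → finrank K A + i ≤ finrank K (B i) := by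
    intro i
    induction i with
    | zero => intro _; exact Submodule.finrank_mono le_sup_left
    | succ i ih =>
      intro h
      have h1 := ih fun j hj => h j (by omega)
      have h2 : B i < B (i + 1) := by
        refine lt_of_le_of_ne (sup_le_sup_left (Submodule.map_mono (degreeLT_mono (by omega))) _) ?_
        intro he
        apply h i (by omega)
        rw [he]
        refine Submodule.mem_sup_right ⟨X ^ i, ?_, by simp [hL]⟩
        rw [SetLike.mem_coe, mem_degreeLT, degree_X_pow]
        exact_mod_cast Nat.lt_succ_self i
      have := Submodule.finrank_lt_finrank_of_lt h2
      omega
  have hex : ∃ j, (x ^ j) v ∈ B j := by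
    by_contra! hcon
    have := hB (finrank K V + 1) fun j _ => hcon j
    have := Submodule.finrank_le (B (finrank K V + 1))
    omega
  have hD := Nat.find_spec hex
  have hmin := hB (Nat.find hex) fun j hj => Nat.find_min hex hj
  generalize hDD : Nat.find hex = D at hD hmin
  obtain ⟨a, ha, _, ⟨p, hp, rfl⟩, hsum⟩ := Submodule.mem_sup.1 hD
  have hp' : p.degree < D := mem_degreeLT.1 hp
  have hmonic : (X ^ D - p).Monic := monic_X_pow_sub hp'
  have hdeg : (X ^ D - p).natDegree = D := by
    rw [natDegree_eq_of_degree_eq_some]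
    rw [degree_sub_eq_left_of_degree_lt] <;> rw [degree_X_pow]
    exact hp'
  have hD0 : 0 < D := by
    rcases Nat.eq_zero_or_pos D with rfl | h
    · exfalso
      apply hv
      have : p = 0 := by simpa [Nat.cast_withBot] using hp'
      subst this
      have : a = v := by simpa using hsum
      exact this ▸ ha
    · exact h
  have hψ : aeval x (X ^ D - p) v ∈ A := by
    have : aeval x (X ^ D - p) v = a := by
      rw [map_sub, LinearMap.sub_apply, ← hL p, map_pow, aeval_X, ← hsum, add_sub_cancel_right]
    rwa [this]
  refine ⟨X ^ D - p, A ⊔ LinearMap.range L, hmonic, by omega, hψ, le_sup_left, ?_, ?_, ?_⟩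
  · intro b hb
    obtain ⟨b, hbA, _, ⟨r, rfl⟩, rfl⟩ := Submodule.mem_sup.1 hb
    rw [map_add]
    refine Submodule.add_mem_sup (hA b hbA) ⟨X * r, ?_⟩
    simp [hL]
  · rw [hdeg]
    exact hmin.trans (Submodule.finrank_mono (sup_le_sup_left LinearMap.map_le_range _))
  · generalize X ^ D - p = ψ at hψ
    -- Evaluation at v. Its values are killed by ψ(x), because c kills ψ(x)v ∈ A and commutes with
    -- ψ(x); its kernel vanishes on A + K[x]v.
    let T : commutantVanishing x A →ₗ[K] V :=
      (LinearMap.applyₗ v).comp (commutantVanishing x A).subtype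
    have hT : ∀ c, T c = c.1 v := fun c => rfl
    have hr : LinearMap.range T ≤ LinearMap.ker (aeval x ψ) := by
      rintro _ ⟨c, rfl⟩
      rw [LinearMap.mem_ker, hT, ← aeval_apply_commute c.2.1]
      exact c.2.2 _ hψ
    have hk : (LinearMap.ker T).map (commutantVanishing x A).subtype ≤
        commutantVanishing x (A ⊔ LinearMap.range L) := by
      rintro _ ⟨c, hc, rfl⟩
      refine ⟨c.2.1, fun b hb => ?_⟩
      obtain ⟨b, hbA, _, ⟨r, rfl⟩, rfl⟩ := Submodule.mem_sup.1 hb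
      have hc' : c.1 v = 0 := hc
      change c.1 (b + L r) = 0
      rw [map_add, c.2.2 b hbA, hL, aeval_apply_commute c.2.1, hc', map_zero, add_zero]
    have h1 := LinearMap.finrank_range_add_finrank_ker T
    have h2 := Submodule.finrank_mono hr
    have h3 := Submodule.finrank_mono hk
    rw [Submodule.finrank_map_subtype_eq] at h3
    omega

theorem finrank_ker_aeval_le_of_dvd (x : End K V) {p r : K[X]} (h : p ∣ r) :
    finrank K (LinearMap.ker (aeval x p)) ≤ finrank K (LinearMap.ker (aeval x r)) := by
  obtain ⟨s, rfl⟩ := h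
  apply Submodule.finrank_mono
  intro v hv
  rw [LinearMap.mem_ker] at hv ⊢
  rw [mul_comm, map_mul, Module.End.mul_apply, hv, map_zero]

/-- If the kernels of all polynomials in `x` of degree at least `D` are small, then so is the
commutant of `x`. -/
theorem finrank_commutant_le (x : End K V) (m D : ℕ) (hD : 0 < D) (Ψ : K[X]) (hΨ : Ψ.Monic)
    (hΨD : D ≤ Ψ.natDegree) (hdvd : ∀ ψ : K[X], ψ.Monic → ψ.natDegree < D → ψ ∣ Ψ)
    (h : ∀ ψ : K[X], ψ.Monic → D ≤ ψ.natDegree →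
      finrank K (LinearMap.ker (aeval x ψ)) ≤ m * ψ.natDegree) :
    finrank K (commutantVanishing x ⊥) ≤ m * finrank K V + m * D * (m * Ψ.natDegree) := by
  -- First stage: enlarge A at a cost of at most m per dimension, as long as some vector has a
  -- conductor of degree at least D.
  let S : Set (Submodule K V) := {A | (∀ a ∈ A, x a ∈ A) ∧
    finrank K (commutantVanishing x ⊥) ≤ finrank K (commutantVanishing x A) + m * finrank K A}
  obtain ⟨A, ⟨hA, hAle⟩, hmax⟩ := WellFounded.has_min (wellFounded_gt (α := Submodule K V)) S
    ⟨⊥, by simp [S]⟩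
  -- At a maximal A every conductor has degree below D and hence divides Ψ. So A contains the image
  -- of Ψ(x), and its codimension is at most dim ker Ψ(x).
  have hcond : ∀ v, aeval x Ψ v ∈ A := by
    intro v
    by_cases hv : v ∈ A
    · exact aeval_apply_mem hA _ hv
    obtain ⟨ψ, A', hψ, hψ0, hψv, hAA', hA', hfr, hc⟩ := exists_conductor x A hA hv
    by_cases hdeg : ψ.natDegree < D
    · obtain ⟨s, rfl⟩ := hdvd ψ hψ hdeg
      rw [mul_comm, map_mul, Module.End.mul_apply]
      exact aeval_apply_mem hA _ hψv
    · exfalso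
      refine hmax A' ⟨hA', ?_⟩ ?_
      · have h1 := h ψ hψ (by omega)
        have h2 := Nat.mul_le_mul_left m hfr
        rw [mul_add] at h2
        omega
      · refine lt_of_le_of_ne hAA' ?_
        rintro rfl
        omega
  have hcodim : finrank K V ≤ finrank K A + m * Ψ.natDegree := by
    have h1 := LinearMap.finrank_range_add_finrank_ker (aeval x Ψ)
    have h2 : finrank K (LinearMap.range (aeval x Ψ)) ≤ finrank K A := by
      apply Submodule.finrank_mono
      rintro _ ⟨v, rfl⟩
      exact hcond v
    have h3 := h Ψ hΨ hΨD
    omega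
  have hsmall : ∀ ψ : K[X], ψ.Monic → 0 < ψ.natDegree →
      finrank K (LinearMap.ker (aeval x ψ)) ≤ m * D * ψ.natDegree := by
    intro ψ hψ hpos
    by_cases hdeg : ψ.natDegree < D
    · have hm : (ψ * X ^ (D - ψ.natDegree)).Monic := hψ.mul (monic_X_pow _)
      have hd : (ψ * X ^ (D - ψ.natDegree)).natDegree = D := by
        rw [hψ.natDegree_mul (monic_X_pow _), natDegree_X_pow]
        omega
      refine (finrank_ker_aeval_le_of_dvd x (dvd_mul_right ψ _)).trans
        ((h _ hm (by omega)).trans ?_)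
      rw [hd]
      exact Nat.le_mul_of_pos_right _ hpos
    · refine (h ψ hψ (by omega)).trans ?_
      rw [mul_assoc]
      exact Nat.mul_le_mul_left m (Nat.le_mul_of_pos_left _ hD)
  -- Second stage: go from A to V at the worse cost m * D per dimension, which is affordable because
  -- the codimension of A is bounded. The inequality is arranged to avoid subtraction.
  let S' : Set (Submodule K V) := {B | (∀ a ∈ B, x a ∈ B) ∧ A ≤ B ∧
    finrank K (commutantVanishing x ⊥) + m * D * finrank K A ≤
      finrank K (commutantVanishing x B) + m * finrank K A + m * D * finrank K B}
  obtain ⟨B, ⟨hB, hAB, hBle⟩, hmax'⟩ := WellFounded.has_min (wellFounded_gt (α := Submodule K V))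
    S' ⟨A, hA, le_rfl, by omega⟩
  have hBtop : B = ⊤ := by
    rw [Submodule.eq_top_iff']
    intro v
    by_contra hv
    obtain ⟨ψ, A', hψ, hψ0, hψv, hAA', hA', hfr, hc⟩ := exists_conductor x B hB hv
    refine hmax' A' ⟨hA', hAB.trans hAA', ?_⟩ ?_
    · have h1 := hsmall ψ hψ hψ0
      have h2 := Nat.mul_le_mul_left (m * D) hfr
      rw [mul_add] at h2
      omega
    · refine lt_of_le_of_ne hAA' ?_
      rintro rfl
      omega
  subst hBtop
  have hz : finrank K (commutantVanishing x ⊤) = 0 := by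
    have : commutantVanishing x ⊤ = ⊥ := by
      rw [eq_bot_iff]
      rintro c ⟨-, hc⟩
      exact LinearMap.ext fun v => hc v trivial
    rw [this, finrank_bot]
  rw [hz, finrank_top] at hBle
  have h4 := Nat.mul_le_mul_left (m * D) hcodim
  have h5 := Nat.mul_le_mul_left m (Submodule.finrank_le A)
  rw [mul_add] at h4
  omega

end Commutant

/-! ### Monic polynomials of bounded degree over a finite field -/

section MonicPolynomials

open Polynomial

variable (K : Type*) [Field K] [Fintype K]

/-- The monic polynomials of degree `E` over a finite field. -/
noncomputable def monicPolynomials (E : ℕ) : Finset K[X] := by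
  classical
  exact Finset.univ.image fun f : Fin E → K => X ^ E + ((degreeLTEquiv K E).symm f).1

variable {K}

theorem mem_monicPolynomials {E : ℕ} {ψ : K[X]} :
    ψ ∈ monicPolynomials K E ↔ ψ.Monic ∧ ψ.natDegree = E := by
  simp only [monicPolynomials, Finset.mem_image, Finset.mem_univ, true_and]
  constructor
  · rintro ⟨f, rfl⟩
    have h := mem_degreeLT.1 ((degreeLTEquiv K E).symm f).2
    refine ⟨monic_X_pow_add h, ?_⟩
    rw [natDegree_eq_of_degree_eq_some]
    rw [degree_add_eq_left_of_degree_lt] <;> rw [degree_X_pow]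
    exact h
  · rintro ⟨hm, rfl⟩
    have hdeg : ψ - X ^ ψ.natDegree ∈ degreeLT K ψ.natDegree := by
      rw [mem_degreeLT, ← degree_eq_natDegree hm.ne_zero]
      exact degree_sub_lt_left (by rw [degree_X_pow, degree_eq_natDegree hm.ne_zero]) hm.ne_zero
        (by rw [hm.leadingCoeff, leadingCoeff_X_pow])
    exact ⟨degreeLTEquiv K _ ⟨_, hdeg⟩, by simp⟩

theorem card_monicPolynomials_le (E : ℕ) :
    (monicPolynomials K E).card ≤ Fintype.card K ^ E := by
  classical
  unfold monicPolynomials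
  exact Finset.card_image_le.trans (by simp)

/-- Take X^D times the product of all monic polynomials of degree below D; the factor X^D secures
the lower bound on the degree. For D = 1 the product is 1, so the degree is bounded independently of
the field, as the large-field case needs. -/
theorem exists_monic_dvd (D : ℕ) : ∃ Ψ : K[X], Ψ.Monic ∧ D ≤ Ψ.natDegree ∧
    Ψ.natDegree ≤ D + D * (D * Fintype.card K ^ D) ∧
    (D = 1 → Ψ.natDegree ≤ 1) ∧
    ∀ ψ : K[X], ψ.Monic → ψ.natDegree < D → ψ ∣ Ψ := by
  have hm : ∀ E, (∏ ψ ∈ monicPolynomials K E, ψ).Monic := fun E =>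
    monic_prod_of_monic _ _ fun ψ hψ => (mem_monicPolynomials.1 hψ).1
  have hd : ∀ E, (∏ ψ ∈ monicPolynomials K E, ψ).natDegree ≤ E * Fintype.card K ^ E := by
    intro E
    rw [natDegree_prod_of_monic _ _ fun ψ hψ => (mem_monicPolynomials.1 hψ).1,
      Finset.sum_congr rfl fun ψ hψ => (mem_monicPolynomials.1 hψ).2, Finset.sum_const,
      smul_eq_mul, mul_comm]
    exact Nat.mul_le_mul_left _ (card_monicPolynomials_le E)
  have hm' : (∏ E ∈ Finset.range D, ∏ ψ ∈ monicPolynomials K E, ψ).Monic :=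
    monic_prod_of_monic _ _ fun E _ => hm E
  have hd' : (∏ E ∈ Finset.range D, ∏ ψ ∈ monicPolynomials K E, ψ).natDegree ≤
      ∑ E ∈ Finset.range D, E * Fintype.card K ^ E := by
    rw [natDegree_prod_of_monic _ _ fun E _ => hm E]
    exact Finset.sum_le_sum fun E _ => hd E
  have hdeg := (monic_X_pow (R := K) D).natDegree_mul hm'
  rw [natDegree_X_pow] at hdeg
  refine ⟨X ^ D * ∏ E ∈ Finset.range D, ∏ ψ ∈ monicPolynomials K E, ψ,
    (monic_X_pow D).mul hm', by omega, ?_, ?_, ?_⟩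
  · rw [hdeg]
    refine Nat.add_le_add_left (hd'.trans ?_) _
    refine (Finset.sum_le_card_nsmul _ _ (D * Fintype.card K ^ D) fun E hE => ?_).trans (by simp)
    have := Finset.mem_range.1 hE
    exact Nat.mul_le_mul this.le (Nat.pow_le_pow_right Fintype.card_pos this.le)
  · rintro rfl
    rw [hdeg]
    simpa using hd'
  · intro ψ hψ hlt
    refine dvd_mul_of_dvd_right (dvd_trans ?_
      (Finset.dvd_prod_of_mem _ (Finset.mem_range.2 hlt))) _
    exact Finset.dvd_prod_of_mem (fun ψ => ψ) (mem_monicPolynomials.2 ⟨hψ, rfl⟩)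

end MonicPolynomials

/-! ### Averaging over partial group actions -/

section Averaging

/-- Averaging over the orbits of a family of partial group actions. -/
theorem card_mul_le_of_forall_card_mul_le {X H : Type*} [Finite X] [Group H] [Finite H]
    (Γ : X → Subgroup H) (act : X → H → X)
    (hΓ : ∀ g, ∀ s ∈ Γ g, Γ (act g s) = Γ g)
    (hact : ∀ g, ∀ s ∈ Γ g, act (act g s) s⁻¹ = g)
    (S : X → Prop) (N M : ℕ)
    (h : ∀ g, Nat.card {s : Γ g // S (act g s)} * N ≤ M * Nat.card (Γ g)) :
    Nat.card {g // S g} * N ≤ M * Nat.card X := by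
  classical
  have := Fintype.ofFinite X
  have := Fintype.ofFinite H
  have hsum : ∀ (f : X → ℚ), ∑ g, ∑ s : H, (if s ∈ Γ g then f g / Nat.card (Γ g) else 0) =
      ∑ g, f g := by
    intro f
    refine Finset.sum_congr rfl fun g _ => ?_
    rw [← Finset.sum_filter, Finset.sum_const, nsmul_eq_mul]
    have hc : (Finset.univ.filter fun s => s ∈ Γ g).card = Nat.card (Γ g) := by
      rw [Nat.card_eq_fintype_card, Fintype.card_subtype]
    rw [hc]
    have : (Nat.card (Γ g) : ℚ) ≠ 0 := by exact_mod_cast Nat.card_pos.ne'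
    field_simp
  -- Weigh each pair (g, s) with s ∈ Γ g by 1/|Γ g|. The map (g, s) ↦ (act g s, s⁻¹) is a
  -- weight-preserving involution of these pairs, so re-randomizing g by s leaves the uniform
  -- distribution unchanged.
  have hswap : ∀ (f : X → ℚ),
      ∑ g, ∑ s : H, (if s ∈ Γ g then f g / Nat.card (Γ g) else 0) =
      ∑ g, ∑ s : H, (if s ∈ Γ g then f (act g s) / Nat.card (Γ g) else 0) := by
    intro f
    simp only [← Fintype.sum_prod_type']
    rw [← Finset.sum_filter, ← Finset.sum_filter]
    refine Finset.sum_nbij' (fun p => (act p.1 p.2, p.2⁻¹)) (fun p => (act p.1 p.2, p.2⁻¹))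
      ?_ ?_ ?_ ?_ ?_
    · rintro ⟨g, s⟩ hp
      simp only [Finset.mem_filter, Finset.mem_univ, true_and] at hp ⊢
      rw [hΓ g s hp]
      exact inv_mem hp
    · rintro ⟨g, s⟩ hp
      simp only [Finset.mem_filter, Finset.mem_univ, true_and] at hp ⊢
      rw [hΓ g s hp]
      exact inv_mem hp
    · rintro ⟨g, s⟩ hp
      simp only [Finset.mem_filter, Finset.mem_univ, true_and] at hp
      simp [hact g s hp]
    · rintro ⟨g, s⟩ hp
      simp only [Finset.mem_filter, Finset.mem_univ, true_and] at hp
      simp [hact g s hp]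
    · rintro ⟨g, s⟩ hp
      simp only [Finset.mem_filter, Finset.mem_univ, true_and] at hp
      simp [hact g s hp, hΓ g s hp]
  have key := (hsum fun g => if S g then 1 else 0).symm.trans (hswap _)
  have hle : (∑ g, (if S g then (1 : ℚ) else 0)) * N ≤ M * Fintype.card X := by
    rw [key, Finset.sum_mul, mul_comm (M : ℚ), ← nsmul_eq_mul]
    refine (Finset.sum_le_card_nsmul _ _ (M : ℚ) fun g _ => ?_).trans_eq (by simp)
    have hpos : (0 : ℚ) < Nat.card (Γ g) := by exact_mod_cast Nat.card_pos
    have hcount : ∑ s : H, (if s ∈ Γ g then (if S (act g s) then (1 : ℚ) else 0) /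
        Nat.card (Γ g) else 0) = Nat.card {s : Γ g // S (act g s)} / Nat.card (Γ g) := by
      rw [← Finset.sum_filter, ← Finset.sum_div]
      congr 1
      rw [← Finset.sum_filter, Finset.filter_filter, Finset.sum_const, nsmul_eq_mul, mul_one,
        ← Fintype.card_subtype, ← Nat.card_eq_fintype_card]
      congr 1
      exact Nat.card_congr (Equiv.subtypeSubtypeEquivSubtypeInter _ _).symm
    rw [hcount, div_mul_eq_mul_div, div_le_iff₀ hpos]
    exact_mod_cast h g
  rw [Finset.sum_boole] at hle
  rw [Nat.card_eq_fintype_card, Nat.card_eq_fintype_card, Fintype.card_subtype]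
  exact_mod_cast hle

/-- Orbit-stabilizer: s ↦ s • v has fibres no larger than the stabilizer, so a random image of v
hits T with probability at most |T| over the orbit size. -/
theorem card_smul_mem_mul_le {Γ Y : Type*} [Group Γ] [Finite Γ] [MulAction Γ Y] [Finite Y]
    (v : Y) (T : Set Y) :
    Nat.card {s : Γ // s • v ∈ T} * (MulAction.orbit Γ v).ncard ≤ T.ncard * Nat.card Γ := by
  classical
  have := Fintype.ofFinite Γ
  have := Fintype.ofFinite Y
  have hos : (MulAction.orbit Γ v).ncard * Nat.card (MulAction.stabilizer Γ v) = Nat.card Γ := by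
    rw [← Nat.card_coe_set_eq, ← Nat.card_prod]
    exact (Nat.card_congr (MulAction.orbitProdStabilizerEquivGroup Γ v))
  have hfib : ∀ y, (Finset.univ.filter fun s : Γ => s • v = y).card ≤
      Nat.card (MulAction.stabilizer Γ v) := by
    intro y
    rcases (Finset.univ.filter fun s : Γ => s • v = y).eq_empty_or_nonempty with h0 | ⟨t, ht⟩
    · simp [h0]
    · rw [Nat.card_eq_fintype_card, ← Finset.card_univ]
      have ht' : t • v = y := by simpa using ht
      refine Finset.card_le_card_of_injOn (fun s => if h : t⁻¹ * s ∈ MulAction.stabilizer Γ v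
        then ⟨t⁻¹ * s, h⟩ else 1) (fun _ _ => Finset.mem_coe.2 (Finset.mem_univ _)) ?_
      have hmem : ∀ s : Γ, s • v = y → t⁻¹ * s ∈ MulAction.stabilizer Γ v := by
        intro s hs
        rw [MulAction.mem_stabilizer_iff, mul_smul, hs, ← ht', inv_smul_smul]
      intro s hs s' hs' he
      have hs : s • v = y := by simpa using hs
      have hs' : s' • v = y := by simpa using hs'
      simp only [dif_pos (hmem s hs), dif_pos (hmem s' hs')] at he
      simpa using he
  have hT : Nat.card {s : Γ // s • v ∈ T} ≤ T.ncard * Nat.card (MulAction.stabilizer Γ v) := by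
    rw [Nat.card_eq_fintype_card, Fintype.card_subtype, Set.ncard_eq_toFinset_card', mul_comm]
    refine Finset.card_le_mul_card_image_of_maps_to (f := fun s : Γ => s • v) ?_ _ ?_
    · intro s hs
      simpa using hs
    · intro y _
      refine (Finset.card_le_card ?_).trans (hfib y)
      intro s hs
      simp only [Finset.mem_filter, Finset.mem_univ, true_and] at hs ⊢
      exact hs.2
  calc _ ≤ T.ncard * Nat.card (MulAction.stabilizer Γ v) * (MulAction.orbit Γ v).ncard :=
        Nat.mul_le_mul_right _ hT
    _ = _ := by rw [mul_assoc, mul_comm (Nat.card _), hos]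

end Averaging

/-! ### Random trajectories of a vector -/

section Trajectories

open Module

variable {K V : Type*} [Field K] [AddCommGroup V] [Module K V]

/-- The pointwise stabilizers in `H` of subspaces containing a fixed small subspace have large
orbits on the vectors outside the subspace. -/
def HasLargeOrbits (H : Subgroup (V ≃ₗ[K] V)) (b : ℕ) : Prop :=
  ∃ R : Submodule K V, finrank K R ≤ 2 ∧ ∀ D : Submodule K V, R ≤ D → ∀ v ∉ D,
    2 * finrank K D + b ≤ finrank K V → Nat.card K ^ finrank K V ≤
      Nat.card K ^ (2 * finrank K D + b) *
        {y | ∃ s ∈ H, (∀ x ∈ D, s x = x) ∧ s v = y}.ncard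

variable {H : Subgroup (V ≃ₗ[K] V)} {d : ℕ}

/-- The value of a letter of the free group at a tuple. -/
def letterValue {G : Type*} [Group G] (g : Fin d → G) (p : Fin d × Bool) : G :=
  cond p.2 (g p.1) (g p.1)⁻¹

/-- The tuple for which the value of the letter `p` is multiplied by `s` on the right. -/
def twistLetter {G : Type*} [Group G] (g : Fin d → G) (p : Fin d × Bool) (s : G) : Fin d → G :=
  Function.update g p.1 (cond p.2 (g p.1 * s) (s⁻¹ * g p.1))

theorem letterValue_twistLetter {G : Type*} [Group G] (g : Fin d → G) (p : Fin d × Bool) (s : G) :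
    letterValue (twistLetter g p s) p = letterValue g p * s := by
  rcases p with ⟨i, _ | _⟩ <;> simp [letterValue, twistLetter]

theorem twistLetter_twistLetter_inv {G : Type*} [Group G] (g : Fin d → G) (p : Fin d × Bool)
    (s : G) : twistLetter (twistLetter g p s) p s⁻¹ = g := by
  rcases p with ⟨i, _ | _⟩ <;> simp [twistLetter]

/-- The trajectory of a vector under a sequence of letters. -/
def trajectory (a : ℕ → Fin d × Bool) (g : Fin d → H) (v : V) : ℕ → V
  | 0 => v
  | j + 1 => (letterValue g (a j)).1 (trajectory a g v j)

/-- An earlier occurrence of the letter a_j applies the extra s to a vector fixed by s. An earlier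
occurrence of its inverse applies s⁻¹ after arriving at the next vector, which is also fixed unless
the arrival is at time j. -/
theorem trajectory_twistLetter (a : ℕ → Fin d × Bool)
    (ha : ∀ j, (a j).1 = (a (j + 1)).1 → (a j).2 = (a (j + 1)).2) (g : Fin d → H) (v : V) (j : ℕ)
    (s : H) (hs : ∀ t < j, s.1 (trajectory a g v t) = trajectory a g v t) (t : ℕ) (ht : t ≤ j) :
    trajectory a (twistLetter g (a j) s) v t = trajectory a g v t := by
  induction t with
  | zero => rfl
  | succ t ih =>
    rw [trajectory, ih (by omega)]
    by_cases h1 : (a t).1 = (a j).1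
    · by_cases h2 : (a t).2 = (a j).2
      · rw [Prod.ext h1 h2, letterValue_twistLetter]
        change (letterValue g (a j)).1 (s.1 (trajectory a g v t)) = _
        rw [hs t (by omega), trajectory, Prod.ext h1 h2]
      · have h3 : t + 1 < j := by
          refine lt_of_le_of_ne ht ?_
          rintro rfl
          exact h2 (ha t h1)
        have hinv : ∀ f : Fin d → H, letterValue f (a t) = (letterValue f (a j))⁻¹ := by
          intro f
          rw [letterValue, letterValue, h1]
          cases hb : (a t).2 <;> cases hc : (a j).2 <;> simp_all
        rw [hinv, letterValue_twistLetter, mul_inv_rev, ← hinv]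
        change (s⁻¹).1 (trajectory a g v (t + 1)) = _
        have h4 := hs (t + 1) h3
        conv_lhs => rw [← h4]
        change (s⁻¹ * s).1 _ = _
        rw [inv_mul_cancel]
        rfl
    · rw [trajectory]
      congr 2
      simp [letterValue, twistLetter, Function.update_of_ne h1]

/-- The span of `R` and the first `j` terms of the trajectory. -/
def trajectorySpan (R : Submodule K V) (a : ℕ → Fin d × Bool) (g : Fin d → H) (v : V) (j : ℕ) :
    Submodule K V :=
  R ⊔ Submodule.span K (trajectory a g v '' Set.Iio j)

theorem finrank_trajectorySpan_le (R : Submodule K V) [FiniteDimensional K V] (hR : finrank K R ≤ 2)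
    (a : ℕ → Fin d × Bool) (g : Fin d → H) (v : V) (j : ℕ) :
    finrank K (trajectorySpan R a g v j) ≤ j + 2 := by
  have h1 := Submodule.finrank_add_le_finrank_add_finrank R
    (Submodule.span K (trajectory a g v '' Set.Iio j))
  have h2 : finrank K (Submodule.span K (trajectory a g v '' Set.Iio j)) ≤ j := by
    classical
    have h3 := finrank_span_finset_le_card (R := K) ((Finset.range j).image (trajectory a g v))
    have h4 := Finset.card_image_le (s := Finset.range j) (f := trajectory a g v)
    rw [Finset.card_range] at h4
    rw [Finset.coe_image, Finset.coe_range] at h3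
    exact h3.trans h4
  change finrank K (R ⊔ _ : Submodule K V) ≤ _
  omega

instance finite_linearEquiv [Finite V] : Finite (V ≃ₗ[K] V) := DFunLike.finite _

/-- The elements of `H` that fix a subspace pointwise. -/
def pointwiseFixing (H : Subgroup (V ≃ₗ[K] V)) (D : Submodule K V) : Subgroup H where
  carrier := {s | ∀ x ∈ D, s.1 x = x}
  one_mem' := fun _ _ => rfl
  mul_mem' := by
    intro a b ha hb x hx
    change a.1 (b.1 x) = x
    rw [hb x hx, ha x hx]
  inv_mem' := by
    intro a ha x hx
    have h : (a⁻¹ * a).1 x = x := by rw [inv_mul_cancel]; rfl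
    have h' : (a⁻¹ * a).1 x = (a⁻¹).1 (a.1 x) := rfl
    rwa [h', ha x hx] at h

/-- Randomize the letter at time j by the pointwise stabilizer of the span D so far; neither the
trajectory up to time j nor the two spans change. The exponent is (2(j + 2) + b) + (j + 3): the
first part is the loss in the orbit bound, as dim D ≤ j + 2, the second the dimension of the space
that must be avoided. -/
theorem card_collision_mul_le [Finite V] {R : Submodule K V} {b : ℕ} (hR : finrank K R ≤ 2)
    (hH : ∀ D : Submodule K V, R ≤ D → ∀ v ∉ D,
      2 * finrank K D + b ≤ finrank K V → Nat.card K ^ finrank K V ≤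
      Nat.card K ^ (2 * finrank K D + b) *
        {y | ∃ s ∈ H, (∀ x ∈ D, s x = x) ∧ s v = y}.ncard) [Finite K]
    (a : ℕ → Fin d × Bool)
    (ha : ∀ j, (a j).1 = (a (j + 1)).1 → (a j).2 = (a (j + 1)).2) (v : V) (j : ℕ)
    (hj : 2 * (j + 2) + b ≤ finrank K V) :
    Nat.card {g : Fin d → H // trajectory a g v j ∉ trajectorySpan R a g v j ∧
      trajectory a g v (j + 1) ∈ trajectorySpan R a g v (j + 1)} * Nat.card K ^ finrank K V ≤
      Nat.card K ^ (3 * j + b + 7) * Nat.card (Fin d → H) := by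
  have hκ : 0 < Nat.card K := Nat.card_pos
  have : FiniteDimensional K V := Module.Finite.of_finite
  have htraj : ∀ g : Fin d → H, ∀ s ∈ pointwiseFixing H (trajectorySpan R a g v j), ∀ t ≤ j,
      trajectory a (twistLetter g (a j) s) v t = trajectory a g v t := by
    intro g s hs t ht
    refine trajectory_twistLetter a ha g v j s (fun t ht => hs _ ?_) t ht
    exact Submodule.mem_sup_right (Submodule.subset_span ⟨t, ht, rfl⟩)
  have hspan : ∀ g : Fin d → H, ∀ s ∈ pointwiseFixing H (trajectorySpan R a g v j), ∀ t ≤ j + 1,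
      trajectorySpan R a (twistLetter g (a j) s) v t = trajectorySpan R a g v t := by
    intro g s hs t ht
    rw [trajectorySpan, trajectorySpan]
    congr 2
    refine Set.image_congr fun i hi => htraj g s hs i ?_
    have : i < t := hi
    omega
  refine card_mul_le_of_forall_card_mul_le
    (fun g => pointwiseFixing H (trajectorySpan R a g v j)) (fun g s => twistLetter g (a j) s)
    ?_ ?_ _ _ _ ?_
  · intro g s hs
    rw [hspan g s hs j (by omega)]
  · intro g s _
    exact twistLetter_twistLetter_inv g (a j) s
  · intro g
    set D := trajectorySpan R a g v j with hD
    set y := trajectory a g v j with hy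
    by_cases hyD : y ∈ D
    · have : IsEmpty {s : pointwiseFixing H D //
          trajectory a (twistLetter g (a j) s) v j ∉
            trajectorySpan R a (twistLetter g (a j) s) v j ∧
          trajectory a (twistLetter g (a j) s) v (j + 1) ∈
            trajectorySpan R a (twistLetter g (a j) s) v (j + 1)} := by
        refine ⟨fun s => s.2.1 ?_⟩
        rw [htraj g _ s.1.2 j le_rfl, hspan g _ s.1.2 j (by omega)]
        exact hyD
      simp
    · let T : Set V := (letterValue g (a j)).1 ⁻¹' (trajectorySpan R a g v (j + 1))
      have hTcard : T.ncard ≤ Nat.card K ^ (j + 3) := by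
        have h1 : T = (letterValue g (a j)).1.symm '' (trajectorySpan R a g v (j + 1)) :=
          ((letterValue g (a j)).1.toEquiv.image_symm_eq_preimage _).symm
        rw [h1, Set.ncard_image_of_injective _ (letterValue g (a j)).1.symm.injective,
          ← Nat.card_coe_set_eq]
        have h2 := Module.natCard_eq_pow_finrank (K := K) (V := trajectorySpan R a g v (j + 1))
        change Nat.card (trajectorySpan R a g v (j + 1)) ≤ _
        rw [h2]
        exact Nat.pow_le_pow_right hκ (finrank_trajectorySpan_le R hR a g v (j + 1))
      have hsub : Nat.card {s : pointwiseFixing H D //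
          trajectory a (twistLetter g (a j) s) v j ∉
            trajectorySpan R a (twistLetter g (a j) s) v j ∧
          trajectory a (twistLetter g (a j) s) v (j + 1) ∈
            trajectorySpan R a (twistLetter g (a j) s) v (j + 1)} ≤
          Nat.card {s : pointwiseFixing H D // s • y ∈ T} := by
        refine Nat.card_le_card_of_injective (fun s => ⟨s.1, ?_⟩) ?_
        · have h2 := s.2.2
          rw [hspan g _ s.1.2 (j + 1) le_rfl, trajectory, htraj g _ s.1.2 j le_rfl,
            letterValue_twistLetter] at h2
          exact h2
        · intro s s' h
          exact Subtype.ext (Subtype.mk.inj h)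
      have horb := card_smul_mem_mul_le (Γ := pointwiseFixing H D) y T
      have hset : MulAction.orbit (pointwiseFixing H D) y =
          {z | ∃ s ∈ H, (∀ x ∈ D, s x = x) ∧ s y = z} := by
        ext z
        constructor
        · rintro ⟨s, rfl⟩
          exact ⟨s.1.1, s.1.2, s.2, rfl⟩
        · rintro ⟨s, hs, hs', rfl⟩
          exact ⟨⟨⟨s, hs⟩, hs'⟩, rfl⟩
      rw [hset] at horb
      have hDr : finrank K D ≤ j + 2 := finrank_trajectorySpan_le R hR a g v j
      have hlarge := hH D le_sup_left y hyD (by omega)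
      calc _ ≤ Nat.card {s : pointwiseFixing H D // s • y ∈ T} * Nat.card K ^ finrank K V :=
            Nat.mul_le_mul_right _ hsub
        _ ≤ Nat.card {s : pointwiseFixing H D // s • y ∈ T} *
              (Nat.card K ^ (2 * finrank K D + b) *
                {z | ∃ s ∈ H, (∀ x ∈ D, s x = x) ∧ s y = z}.ncard) :=
            Nat.mul_le_mul_left _ hlarge
        _ = Nat.card K ^ (2 * finrank K D + b) * (Nat.card {s : pointwiseFixing H D // s • y ∈ T} *
                {z | ∃ s ∈ H, (∀ x ∈ D, s x = x) ∧ s y = z}.ncard) := by ring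
        _ ≤ Nat.card K ^ (2 * finrank K D + b) * (T.ncard * Nat.card (pointwiseFixing H D)) :=
            Nat.mul_le_mul_left _ horb
        _ ≤ Nat.card K ^ (2 * (j + 2) + b) *
              (Nat.card K ^ (j + 3) * Nat.card (pointwiseFixing H D)) := by
            gcongr
        _ = _ := by
            rw [← mul_assoc, ← pow_add]
            congr 2
            ring

end Trajectories

/-! ### Kernels of polynomials in a random word value -/

section WordKernels

open Module Polynomial

variable {K V : Type*} [Field K] [AddCommGroup V] [Module K V]
variable {H : Subgroup (V ≃ₗ[K] V)} {d : ℕ}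

/-- Union bound over the time of the first collision. Each further step raises the exponent by 3,
which more than covers the doubling of the bound, since 2 ≤ |K|. -/
theorem card_exists_collision_mul_le [Finite V] [Finite K] {R : Submodule K V} {b : ℕ}
    (hR : finrank K R ≤ 2)
    (hH : ∀ D : Submodule K V, R ≤ D → ∀ v ∉ D,
      2 * finrank K D + b ≤ finrank K V → Nat.card K ^ finrank K V ≤
      Nat.card K ^ (2 * finrank K D + b) *
        {y | ∃ s ∈ H, (∀ x ∈ D, s x = x) ∧ s v = y}.ncard)
    (a : ℕ → Fin d × Bool)
    (ha : ∀ j, (a j).1 = (a (j + 1)).1 → (a j).2 = (a (j + 1)).2) {v : V} (hv : v ∉ R) (l : ℕ)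
    (hl : 2 * (l + 2) + b ≤ finrank K V) :
    Nat.card {g : Fin d → H // ∃ j ≤ l, trajectory a g v j ∈ trajectorySpan R a g v j} *
        Nat.card K ^ finrank K V ≤ Nat.card K ^ (3 * l + b + 7) * Nat.card (Fin d → H) := by
  induction l with
  | zero =>
    have : IsEmpty {g : Fin d → H // ∃ j ≤ 0, trajectory a g v j ∈ trajectorySpan R a g v j} := by
      refine ⟨?_⟩
      rintro ⟨g, j, hj, h⟩
      obtain rfl : j = 0 := by omega
      apply hv
      simpa [trajectorySpan, trajectory] using h
    rw [Nat.card_of_isEmpty, zero_mul]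
    exact Nat.zero_le _
  | succ l ih =>
    have h1 := ih (by omega)
    have h2 := card_collision_mul_le hR hH a ha v l (by omega)
    have h3 : Nat.card {g : Fin d → H //
          ∃ j ≤ l + 1, trajectory a g v j ∈ trajectorySpan R a g v j} ≤
        Nat.card {g : Fin d → H // ∃ j ≤ l, trajectory a g v j ∈ trajectorySpan R a g v j} +
        Nat.card {g : Fin d → H // trajectory a g v l ∉ trajectorySpan R a g v l ∧
          trajectory a g v (l + 1) ∈ trajectorySpan R a g v (l + 1)} := by
      refine le_trans ?_ (Set.ncard_union_le
        {g : Fin d → H | ∃ j ≤ l, trajectory a g v j ∈ trajectorySpan R a g v j}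
        {g : Fin d → H | trajectory a g v l ∉ trajectorySpan R a g v l ∧
          trajectory a g v (l + 1) ∈ trajectorySpan R a g v (l + 1)})
      refine Set.ncard_le_ncard (s := {g : Fin d → H |
        ∃ j ≤ l + 1, trajectory a g v j ∈ trajectorySpan R a g v j}) ?_ (Set.toFinite _)
      rintro g ⟨j, hj, h⟩
      by_cases h' : ∃ j ≤ l, trajectory a g v j ∈ trajectorySpan R a g v j
      · exact Or.inl h'
      · push Not at h'
        refine Or.inr ⟨h' l le_rfl, ?_⟩
        rcases Nat.lt_or_ge l j with hlt | hge
        · obtain rfl : j = l + 1 := by omega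
          exact h
        · exact absurd h (h' j hge)
    have h4 : 1 < Nat.card K := Finite.one_lt_card
    calc _ ≤ _ := Nat.mul_le_mul_right _ h3
      _ ≤ (Nat.card K ^ (3 * l + b + 7) + Nat.card K ^ (3 * l + b + 7)) *
          Nat.card (Fin d → H) := by rw [add_mul, add_mul]; exact Nat.add_le_add h1 h2
      _ ≤ _ := by
        refine Nat.mul_le_mul_right _ ?_
        rw [← two_mul]
        calc _ ≤ Nat.card K * Nat.card K ^ (3 * l + b + 7) := Nat.mul_le_mul_right _ h4
          _ = Nat.card K ^ (3 * l + b + 7 + 1) := (pow_succ' _ _).symm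
          _ ≤ _ := Nat.pow_le_pow_right (by omega) (by omega)

/-- The endomorphism given by the value of a word. -/
def wordEnd (w : FreeGroup (Fin d)) (g : Fin d → H) : End K V :=
  ((FreeGroup.lift g w).1 : V →ₗ[K] V)

theorem wordEnd_mul (w₁ w₂ : FreeGroup (Fin d)) (g : Fin d → H) :
    wordEnd (w₁ * w₂) g = wordEnd w₁ g * wordEnd w₂ g := by
  simp only [wordEnd, map_mul]
  rfl

/-- The periodic sequence of letters obtained by reading a word from right to left. -/
def periodicLetters (L : List (Fin d × Bool)) (hL : L ≠ []) (j : ℕ) : Fin d × Bool :=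
  L.reverse[j % L.length]'(by
    rw [List.length_reverse]; exact Nat.mod_lt _ (List.length_pos_iff.2 hL))

/-- Inside a copy of L this is reducedness; at the seam of two copies the first and last letters of
L meet, and cyclic reducedness rules out cancellation. -/
theorem periodicLetters_reduced {L : List (Fin d × Bool)} (hL : L ≠ [])
    (hred : FreeGroup.IsCyclicallyReduced L) (j : ℕ)
    (h : (periodicLetters L hL j).1 = (periodicLetters L hL (j + 1)).1) :
    (periodicLetters L hL j).2 = (periodicLetters L hL (j + 1)).2 := by
  have hpos : 0 < L.length := List.length_pos_iff.2 hL
  have hlt := Nat.mod_lt j hpos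
  rw [FreeGroup.isCyclicallyReduced_iff] at hred
  obtain ⟨hr, hc⟩ := hred
  rcases Nat.lt_or_ge (j % L.length + 1) L.length with h1 | h1
  · have h2 : (j + 1) % L.length = j % L.length + 1 := by
      rw [Nat.add_mod]
      rcases Nat.lt_or_ge 1 L.length with h3 | h3
      · rw [Nat.mod_eq_of_lt h3, Nat.mod_eq_of_lt h1]
      · omega
    simp only [periodicLetters, h2, List.getElem_reverse] at h ⊢
    have := List.isChain_iff_getElem.1 hr (L.length - 1 - (j % L.length + 1)) (by omega)
    have h4 : L.length - 1 - (j % L.length + 1) + 1 = L.length - 1 - j % L.length := by omega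
    simp only [h4] at this
    exact (this h.symm).symm
  · have h2 : j % L.length = L.length - 1 := by omega
    have h3 : (j + 1) % L.length = 0 := by
      rw [Nat.add_mod, h2, Nat.add_mod_mod]
      have : L.length - 1 + 1 = L.length := by omega
      rw [this, Nat.mod_self]
    simp only [periodicLetters, h2, h3, List.getElem_reverse] at h ⊢
    have h4 : L.length - 1 - (L.length - 1) = 0 := by omega
    have h5 : L.length - 1 - 0 = L.length - 1 := by omega
    simp only [h4, h5] at h ⊢
    refine (hc _ ?_ _ ?_ h.symm).symm
    · rw [List.getLast?_eq_getElem?, List.getElem?_eq_getElem (by omega)]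
      rfl
    · rw [List.head?_eq_getElem?, List.getElem?_eq_getElem (by omega)]
      rfl

theorem trajectory_periodicLetters {L : List (Fin d × Bool)} (hL : L ≠ []) (g : Fin d → H) (v : V)
    (k : ℕ) : trajectory (periodicLetters L hL) g v (L.length * k) =
      (wordEnd (FreeGroup.mk L) g ^ k) v := by
  have hpos : 0 < L.length := List.length_pos_iff.2 hL
  have hstep : ∀ k t (ht : t ≤ L.length), trajectory (periodicLetters L hL) g v (L.length * k + t) =
      wordEnd (FreeGroup.mk (L.drop (L.length - t))) g
        (trajectory (periodicLetters L hL) g v (L.length * k)) := by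
    intro k t
    induction t with
    | zero =>
      intro _
      simp [wordEnd, ← FreeGroup.one_eq_mk]
    | succ t ih =>
      intro ht
      have h1 : L.length - t = L.length - (t + 1) + 1 := by omega
      have h2 : L.drop (L.length - (t + 1)) =
          [L[L.length - (t + 1)]'(by omega)] ++ L.drop (L.length - t) := by
        rw [h1, List.drop_eq_getElem_cons (by omega), List.singleton_append]
      have h3 : periodicLetters L hL (L.length * k + t) = L[L.length - (t + 1)]'(by omega) := by
        have h4 : (L.length * k + t) % L.length = t := by
          rw [Nat.mul_add_mod, Nat.mod_eq_of_lt (by omega)]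
        simp only [periodicLetters, h4, List.getElem_reverse]
        congr 1
        omega
      rw [← add_assoc, trajectory, ih (by omega), h2, ← FreeGroup.mul_mk, wordEnd_mul, h3]
      generalize L[L.length - (t + 1)]'(by omega) = p
      rcases p with ⟨i, _ | _⟩ <;> simp [wordEnd, letterValue]
  induction k with
  | zero => simp [trajectory]
  | succ k ih =>
    have := hstep k L.length le_rfl
    rw [mul_add, mul_one, this, ih, Nat.sub_self, List.drop_zero, pow_succ', Module.End.mul_apply]

/-- As ψ is monic, ψ(x)v = 0 expresses x^(deg ψ) v, the trajectory at time |L| deg ψ, through the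
earlier points x^i v at times |L| i: a collision. -/
theorem card_aeval_wordEnd_apply_eq_zero_mul_le [Finite V] [Finite K] {R : Submodule K V} {b : ℕ}
    (hR : finrank K R ≤ 2)
    (hH : ∀ D : Submodule K V, R ≤ D → ∀ v ∉ D,
      2 * finrank K D + b ≤ finrank K V → Nat.card K ^ finrank K V ≤
      Nat.card K ^ (2 * finrank K D + b) *
        {y | ∃ s ∈ H, (∀ x ∈ D, s x = x) ∧ s v = y}.ncard)
    {L : List (Fin d × Bool)} (hL : L ≠ []) (hred : FreeGroup.IsCyclicallyReduced L)
    {v : V} (hv : v ∉ R) {ψ : K[X]} (hψ : ψ.Monic)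
    (hdeg : 2 * (L.length * ψ.natDegree + 2) + b ≤ finrank K V) :
    Nat.card {g : Fin d → H // aeval (wordEnd (FreeGroup.mk L) g) ψ v = 0} *
        Nat.card K ^ finrank K V ≤
      Nat.card K ^ (3 * (L.length * ψ.natDegree) + b + 7) * Nat.card (Fin d → H) := by
  refine le_trans (Nat.mul_le_mul_right _ ?_) (card_exists_collision_mul_le hR hH
    (periodicLetters L hL) (periodicLetters_reduced hL hred) hv _ hdeg)
  refine Nat.card_mono (Set.toFinite {g : Fin d → H | ∃ j ≤ L.length * ψ.natDegree,
    trajectory (periodicLetters L hL) g v j ∈ trajectorySpan R (periodicLetters L hL) g v j}) ?_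
  intro g hg
  have hg : aeval (wordEnd (FreeGroup.mk L) g) ψ v = 0 := hg
  refine ⟨L.length * ψ.natDegree, le_rfl, Submodule.mem_sup_right ?_⟩
  rw [trajectory_periodicLetters]
  rw [aeval_eq_sum_range, Finset.sum_range_succ, LinearMap.add_apply, LinearMap.sum_apply,
    hψ.coeff_natDegree, one_smul] at hg
  rw [eq_neg_of_add_eq_zero_right hg]
  refine Submodule.neg_mem _ (Submodule.sum_mem _ fun i hi => ?_)
  rw [LinearMap.smul_apply, ← trajectory_periodicLetters hL]
  refine Submodule.smul_mem _ _ (Submodule.subset_span ⟨L.length * i, ?_, rfl⟩)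
  exact Nat.mul_lt_mul_of_pos_left (Finset.mem_range.1 hi) (List.length_pos_iff.2 hL)

/-- Markov's inequality for the number of vectors killed by ψ(x). Its mean is at most |K|^2, from
the vectors of R, plus |K|^(3 |L| deg ψ + b + 7) from the others. The constant 11 leaves room for
the saving |K|^(3 deg ψ). -/
theorem card_large_kernel_mul_le [Finite V] [Finite K] {b : ℕ} (hH : HasLargeOrbits H b)
    {L : List (Fin d × Bool)} (hL : L ≠ []) (hred : FreeGroup.IsCyclicallyReduced L)
    {ψ : K[X]} (hψ : ψ.Monic) (hpos : 0 < ψ.natDegree) :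
    Nat.card {g : Fin d → H // (3 * L.length + b + 11) * ψ.natDegree <
        finrank K (LinearMap.ker (aeval (wordEnd (FreeGroup.mk L) g) ψ))} *
      Nat.card K ^ (3 * ψ.natDegree) ≤ Nat.card (Fin d → H) := by
  classical
  have : FiniteDimensional K V := Module.Finite.of_finite
  have := Fintype.ofFinite V
  have := Fintype.ofFinite (Fin d → H)
  have hκ : 1 < Nat.card K := Finite.one_lt_card
  have hlen : 0 < L.length := List.length_pos_iff.2 hL
  set E := ψ.natDegree with hE
  set m := 3 * L.length + b + 11 with hm
  set n := finrank K V with hn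
  set x : (Fin d → H) → End K V := fun g => wordEnd (FreeGroup.mk L) g with hx
  by_cases hdeg : 2 * (L.length * E + 2) + b ≤ n
  · obtain ⟨R, hR, hH⟩ := hH
    have hRcard : (Finset.univ.filter fun v : V => v ∈ R).card ≤ Nat.card K ^ 2 := by
      rw [← Fintype.card_subtype, ← Nat.card_eq_fintype_card]
      rw [Module.natCard_eq_pow_finrank (K := K)]
      exact Nat.pow_le_pow_right (by omega) hR
    have hv : ∀ v : V, (Finset.univ.filter fun g => aeval (x g) ψ v = 0).card * Nat.card K ^ n ≤
        (if v ∈ R then Nat.card K ^ n else 0) * Nat.card (Fin d → H) +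
          Nat.card K ^ (3 * (L.length * E) + b + 7) * Nat.card (Fin d → H) := by
      intro v
      by_cases hvR : v ∈ R
      · rw [if_pos hvR, mul_comm]
        refine le_trans (Nat.mul_le_mul_left _ ?_) (Nat.le_add_right _ _)
        rw [Nat.card_eq_fintype_card]
        exact Finset.card_le_univ _
      · rw [if_neg hvR, zero_mul, zero_add]
        have := card_aeval_wordEnd_apply_eq_zero_mul_le hR hH hL hred hvR hψ hdeg
        rwa [Nat.card_eq_fintype_card (α := {g // _}), Fintype.card_subtype] at this
    have hsum := Finset.sum_le_sum fun v (_ : v ∈ Finset.univ) => hv v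
    rw [← Finset.sum_mul, Finset.sum_add_distrib, ← Finset.sum_mul, ← Finset.sum_filter,
      Finset.sum_const, Finset.sum_const, smul_eq_mul, smul_eq_mul, Finset.card_univ,
      ← Nat.card_eq_fintype_card, Module.natCard_eq_pow_finrank (K := K) (V := V), ← hn] at hsum
    have hcomm : ∑ v : V, (Finset.univ.filter fun g => aeval (x g) ψ v = 0).card =
        ∑ g, (Finset.univ.filter fun v : V => aeval (x g) ψ v = 0).card := by
      simp only [Finset.card_filter]
      exact Finset.sum_comm
    have hbad : (Finset.univ.filter fun g => m * E <
        finrank K (LinearMap.ker (aeval (x g) ψ))).card * Nat.card K ^ (m * E + 1) ≤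
        ∑ g, (Finset.univ.filter fun v : V => aeval (x g) ψ v = 0).card := by
      rw [← smul_eq_mul]
      refine le_trans (Finset.card_nsmul_le_sum _
        (fun g => (Finset.univ.filter fun v : V => aeval (x g) ψ v = 0).card) _ ?_)
        (Finset.sum_le_sum_of_subset (Finset.subset_univ _))
      intro g hg
      have hg' : m * E < finrank K (LinearMap.ker (aeval (x g) ψ)) := by simpa using hg
      have h1 := Module.natCard_eq_pow_finrank (K := K) (V := LinearMap.ker (aeval (x g) ψ))
      have h2 : Nat.card (LinearMap.ker (aeval (x g) ψ)) =
          (Finset.univ.filter fun v : V => aeval (x g) ψ v = 0).card := by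
        rw [← Fintype.card_subtype, ← Nat.card_eq_fintype_card]
        rfl
      rw [← h2, h1]
      exact Nat.pow_le_pow_right (by omega) hg'
    rw [Nat.card_eq_fintype_card, Fintype.card_subtype]
    set B := (Finset.univ.filter fun g => m * E <
        finrank K (LinearMap.ker (aeval (x g) ψ))).card with hB
    rw [hcomm] at hsum
    have hfin : B * Nat.card K ^ (m * E + 1) * Nat.card K ^ n ≤
        Nat.card K ^ (3 * (L.length * E) + b + 8) * Nat.card (Fin d → H) * Nat.card K ^ n := by
      refine (Nat.mul_le_mul_right _ hbad).trans (hsum.trans ?_)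
      have h1 : Nat.card K ^ 2 + Nat.card K ^ (3 * (L.length * E) + b + 7) ≤
          Nat.card K ^ (3 * (L.length * E) + b + 8) := by
        have h2 : Nat.card K ^ 2 ≤ Nat.card K ^ (3 * (L.length * E) + b + 7) :=
          Nat.pow_le_pow_right (by omega) (by omega)
        calc _ ≤ 2 * Nat.card K ^ (3 * (L.length * E) + b + 7) := by omega
          _ ≤ Nat.card K * Nat.card K ^ (3 * (L.length * E) + b + 7) := Nat.mul_le_mul_right _ hκ
          _ = _ := (pow_succ' _ _).symm
      calc _ ≤ Nat.card K ^ 2 * Nat.card K ^ n * Nat.card (Fin d → H) +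
            Nat.card K ^ n * (Nat.card K ^ (3 * (L.length * E) + b + 7) *
              Nat.card (Fin d → H)) := by gcongr
        _ = (Nat.card K ^ 2 + Nat.card K ^ (3 * (L.length * E) + b + 7)) *
            Nat.card (Fin d → H) * Nat.card K ^ n := by ring
        _ ≤ _ := by gcongr
    have hfin := Nat.le_of_mul_le_mul_right hfin (by positivity)
    have hexp : 3 * (L.length * E) + b + 8 + 3 * E ≤ m * E + 1 := by
      have : b * 1 ≤ b * E := Nat.mul_le_mul_left _ hpos
      rw [hm]
      nlinarith
    refine le_of_mul_le_mul_left (?_ : Nat.card K ^ (3 * (L.length * E) + b + 8) * _ ≤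
      Nat.card K ^ (3 * (L.length * E) + b + 8) * _) (by positivity)
    calc _ = B * Nat.card K ^ (3 * (L.length * E) + b + 8 + 3 * E) := by
          rw [pow_add _ _ (3 * E)]; ring
      _ ≤ B * Nat.card K ^ (m * E + 1) :=
          Nat.mul_le_mul_left _ (Nat.pow_le_pow_right (by omega) hexp)
      _ ≤ _ := hfin
  -- In the remaining range of degrees m * E exceeds n, so no kernel can be too large.
  · have : IsEmpty {g : Fin d → H // m * E < finrank K (LinearMap.ker (aeval (x g) ψ))} := by
      refine ⟨?_⟩
      rintro ⟨g, hg⟩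
      have h1 := Submodule.finrank_le (LinearMap.ker (aeval (x g) ψ))
      have : b * 1 ≤ b * E := Nat.mul_le_mul_left _ hpos
      rw [hm] at hg
      nlinarith
    rw [Nat.card_of_isEmpty, zero_mul]
    exact Nat.zero_le _

/-- With high probability, the value of a cyclically reduced word has small polynomial kernels. -/
theorem card_exists_large_kernel_mul_le [Finite V] [Finite K] {b : ℕ} (hH : HasLargeOrbits H b)
    {L : List (Fin d × Bool)} (hL : L ≠ []) (hred : FreeGroup.IsCyclicallyReduced L)
    (D : ℕ) (hD : 0 < D) :
    Nat.card {g : Fin d → H // ∃ ψ : K[X], ψ.Monic ∧ D ≤ ψ.natDegree ∧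
      (3 * L.length + b + 11) * ψ.natDegree <
        finrank K (LinearMap.ker (aeval (wordEnd (FreeGroup.mk L) g) ψ))} *
      Nat.card K ^ D ≤ Nat.card (Fin d → H) := by
  classical
  have : FiniteDimensional K V := Module.Finite.of_finite
  have := Fintype.ofFinite K
  have := Fintype.ofFinite (Fin d → H)
  have hκ : 1 < Nat.card K := Finite.one_lt_card
  set m := 3 * L.length + b + 11 with hm
  set n := finrank K V with hn
  let bad : K[X] → Finset (Fin d → H) := fun ψ => Finset.univ.filter fun g =>
    m * ψ.natDegree < finrank K (LinearMap.ker (aeval (wordEnd (FreeGroup.mk L) g) ψ))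
  have hbad : ∀ ψ : K[X], ψ.Monic → 0 < ψ.natDegree →
      (bad ψ).card * Nat.card K ^ (3 * ψ.natDegree) ≤ Nat.card (Fin d → H) := by
    intro ψ h1 h2
    have := card_large_kernel_mul_le hH hL hred h1 h2
    rwa [Nat.card_eq_fintype_card (α := {g // _}), Fintype.card_subtype] at this
  have hE : ∀ E, 0 < E → ((monicPolynomials K E).biUnion bad).card * Nat.card K ^ (2 * E) ≤
      Nat.card (Fin d → H) := by
    intro E hE
    refine le_of_mul_le_mul_left (?_ : Nat.card K ^ E * _ ≤ Nat.card K ^ E * _) (by positivity)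
    calc _ = ((monicPolynomials K E).biUnion bad).card * Nat.card K ^ (3 * E) := by ring
      _ ≤ (∑ ψ ∈ monicPolynomials K E, (bad ψ).card) * Nat.card K ^ (3 * E) :=
          Nat.mul_le_mul_right _ Finset.card_biUnion_le
      _ = ∑ ψ ∈ monicPolynomials K E, (bad ψ).card * Nat.card K ^ (3 * E) := Finset.sum_mul _ _ _
      _ ≤ ∑ ψ ∈ monicPolynomials K E, Nat.card (Fin d → H) := by
          refine Finset.sum_le_sum fun ψ hψ => ?_
          obtain ⟨h1, rfl⟩ := mem_monicPolynomials.1 hψ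
          exact hbad ψ h1 hE
      _ = (monicPolynomials K E).card * Nat.card (Fin d → H) := by simp
      _ ≤ _ := by
          refine Nat.mul_le_mul_right _ ?_
          rw [Nat.card_eq_fintype_card]
          exact card_monicPolynomials_le E
  -- Degree E contributes at most |K|^(-2E), since |K|^E polynomials share a saving of |K|^(-3E).
  -- This is at most |K|^(-E) - |K|^(-E-1), so the sum over E telescopes.
  have hsub : ∀ N, (((Finset.Ico D (D + N)).biUnion fun E =>
      (monicPolynomials K E).biUnion bad).card : ℚ) ≤
      (((Nat.card K : ℚ) ^ D)⁻¹ - ((Nat.card K : ℚ) ^ (D + N))⁻¹) * Nat.card (Fin d → H) := by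
    intro N
    induction N with
    | zero => simp
    | succ N ih =>
      rw [← add_assoc, ← Finset.insert_Ico_right_eq_Ico_add_one (by omega : D ≤ D + N), Finset.biUnion_insert]
      have h1 := Finset.card_union_le ((monicPolynomials K (D + N)).biUnion bad)
        ((Finset.Ico D (D + N)).biUnion fun E => (monicPolynomials K E).biUnion bad)
      have h2 : (((monicPolynomials K (D + N)).biUnion bad).card : ℚ) ≤
          (((Nat.card K : ℚ) ^ (D + N))⁻¹ - ((Nat.card K : ℚ) ^ (D + N + 1))⁻¹) *
            Nat.card (Fin d → H) := by
        have h3 : (((monicPolynomials K (D + N)).biUnion bad).card : ℚ) *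
            (Nat.card K : ℚ) ^ (2 * (D + N)) ≤ Nat.card (Fin d → H) := by
          exact_mod_cast hE (D + N) (by omega)
        have hk : (2 : ℚ) ≤ Nat.card K := by exact_mod_cast hκ
        have h4 : ((Nat.card K : ℚ) ^ (2 * (D + N)))⁻¹ ≤
            ((Nat.card K : ℚ) ^ (D + N))⁻¹ - ((Nat.card K : ℚ) ^ (D + N + 1))⁻¹ := by
          have h5 : (Nat.card K : ℚ) ^ 1 ≤ (Nat.card K : ℚ) ^ (D + N) :=
            pow_le_pow_right₀ (by linarith) (by omega)
          have h6 : (0 : ℚ) < (Nat.card K : ℚ) ^ (D + N) := by positivity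
          rw [pow_one] at h5
          rw [two_mul, pow_add _ (D + N) (D + N), pow_succ _ (D + N), mul_inv, mul_inv,
            ← mul_one_sub]
          refine mul_le_mul_of_nonneg_left ?_ (by positivity)
          have h7 : ((Nat.card K : ℚ) ^ (D + N))⁻¹ ≤ (Nat.card K : ℚ)⁻¹ :=
            inv_anti₀ (by linarith) h5
          have h8 : (Nat.card K : ℚ)⁻¹ ≤ 2⁻¹ := inv_anti₀ (by norm_num) hk
          linarith
        calc _ ≤ ((Nat.card K : ℚ) ^ (2 * (D + N)))⁻¹ * Nat.card (Fin d → H) := by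
              rw [inv_mul_eq_div, le_div_iff₀ (by positivity)]
              exact h3
          _ ≤ _ := mul_le_mul_of_nonneg_right h4 (by positivity)
      have h1' : (_ : ℚ) ≤ _ := Nat.cast_le.2 h1
      rw [Nat.cast_add] at h1'
      linarith
  -- Finitely many degrees suffice: m deg ψ < dim ker ψ(x) ≤ n forces deg ψ < n.
  have hmono : Nat.card {g : Fin d → H // ∃ ψ : K[X], ψ.Monic ∧ D ≤ ψ.natDegree ∧
      m * ψ.natDegree <
        finrank K (LinearMap.ker (aeval (wordEnd (FreeGroup.mk L) g) ψ))} ≤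
      ((Finset.Ico D (D + n)).biUnion fun E => (monicPolynomials K E).biUnion bad).card := by
    rw [Nat.card_eq_fintype_card, Fintype.card_subtype]
    refine Finset.card_le_card fun g hg => ?_
    simp only [Finset.mem_filter, Finset.mem_univ, true_and] at hg
    obtain ⟨ψ, h1, h2, h3⟩ := hg
    have h4 := Submodule.finrank_le (LinearMap.ker (aeval (wordEnd (FreeGroup.mk L) g) ψ))
    simp only [Finset.mem_biUnion, Finset.mem_Ico]
    refine ⟨ψ.natDegree, ⟨h2, ?_⟩, ψ, mem_monicPolynomials.2 ⟨h1, rfl⟩, by simpa [bad] using h3⟩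
    nlinarith
  have h1 := hsub n
  have h2 : (Nat.card {g : Fin d → H // ∃ ψ : K[X], ψ.Monic ∧ D ≤ ψ.natDegree ∧
      m * ψ.natDegree <
        finrank K (LinearMap.ker (aeval (wordEnd (FreeGroup.mk L) g) ψ))} : ℚ) ≤ _ :=
    Nat.cast_le.2 hmono
  have h3 : (0 : ℚ) ≤ ((Nat.card K : ℚ) ^ (D + n))⁻¹ * Nat.card (Fin d → H) := by positivity
  have h4 : (Nat.card {g : Fin d → H // ∃ ψ : K[X], ψ.Monic ∧ D ≤ ψ.natDegree ∧
      m * ψ.natDegree <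
        finrank K (LinearMap.ker (aeval (wordEnd (FreeGroup.mk L) g) ψ))} : ℚ) ≤
      ((Nat.card K : ℚ) ^ D)⁻¹ * Nat.card (Fin d → H) := by
    rw [sub_mul] at h1
    linarith
  rw [inv_mul_eq_div, le_div_iff₀ (by positivity)] at h4
  exact_mod_cast h4

end WordKernels

/-! ### Counting orbit points; the special linear group -/

section Counting

open Module

theorem ncard_le_mul_ncard_of_mapsTo {α β : Type*} [Finite α] [Finite β] (f : α → β) (s : Set α)
    (t : Set β) (k : ℕ) (hf : ∀ x ∈ s, f x ∈ t)
    (hk : ∀ y, {x | x ∈ s ∧ f x = y}.ncard ≤ k) : s.ncard ≤ k * t.ncard := by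
  classical
  have := Fintype.ofFinite α
  have := Fintype.ofFinite β
  rw [Set.ncard_eq_toFinset_card', Set.ncard_eq_toFinset_card']
  refine Finset.card_le_mul_card_image_of_maps_to (f := f) (fun a ha => ?_) k fun y _ => ?_
  · simpa using hf a (by simpa using ha)
  · refine le_trans (le_of_eq ?_) (hk y)
    rw [Set.ncard_eq_toFinset_card']
    congr 1
    ext x
    simp

variable {K V : Type*} [Field K] [AddCommGroup V] [Module K V] [Finite K] [Finite V]

/-- A subspace maps with small fibres to a set which is therefore large. -/
theorem pow_finrank_le_mul_ncard (Y : Submodule K V) (f : V → V) (S : Set V) (u : V)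
    (hf : ∀ y ∈ Y, f y ∈ S) (hfib : ∀ y ∈ Y, ∀ y' ∈ Y, f y = f y' → ∃ c : K, y' = y + c • u)
    (n e : ℕ) (hn : n + 1 ≤ finrank K Y + e) :
    Nat.card K ^ n ≤ Nat.card K ^ e * S.ncard := by
  have hκ : 0 < Nat.card K := Nat.card_pos
  have h1 : (Y : Set V).ncard ≤ Nat.card K * S.ncard := by
    refine ncard_le_mul_ncard_of_mapsTo f _ _ _ hf fun z => ?_
    rcases Set.eq_empty_or_nonempty {x | x ∈ (Y : Set V) ∧ f x = z} with h0 | ⟨y, hy, hyz⟩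
    · rw [h0, Set.ncard_empty]
      exact Nat.zero_le _
    · refine (Set.ncard_le_ncard (t := (fun c : K => y + c • u) '' Set.univ) ?_
        (Set.toFinite _)).trans ((Set.ncard_image_le (Set.toFinite _)).trans ?_)
      · rintro y' ⟨hy', hy'z⟩
        obtain ⟨c, hc⟩ := hfib y hy y' hy' (hyz.trans hy'z.symm)
        exact ⟨c, trivial, hc.symm⟩
      · rw [Set.ncard_univ]
  have h2 : (Y : Set V).ncard = Nat.card K ^ finrank K Y := by
    rw [← Nat.card_coe_set_eq]
    exact Module.natCard_eq_pow_finrank (K := K) (V := Y)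
  rw [h2] at h1
  refine le_of_mul_le_mul_left (?_ : Nat.card K * _ ≤ Nat.card K * _) hκ
  calc _ = Nat.card K ^ (n + 1) := (pow_succ' _ _).symm
    _ ≤ Nat.card K ^ (finrank K Y + e) := Nat.pow_le_pow_right hκ hn
    _ = Nat.card K ^ e * Nat.card K ^ finrank K Y := by rw [pow_add, mul_comm]
    _ ≤ Nat.card K ^ e * (Nat.card K * S.ncard) := Nat.mul_le_mul_left _ h1
    _ = _ := by ring

theorem HasLargeOrbits.mono {H H' : Subgroup (V ≃ₗ[K] V)} {b b' : ℕ} (h : HasLargeOrbits H b)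
    (hH : H ≤ H') (hb : b ≤ b') : HasLargeOrbits H' b' := by
  obtain ⟨R, hR, h⟩ := h
  refine ⟨R, hR, fun D hD v hv hdim => (h D hD v hv (by omega)).trans ?_⟩
  refine Nat.mul_le_mul (Nat.pow_le_pow_right Nat.card_pos (by omega))
    (Set.ncard_le_ncard ?_ (Set.toFinite _))
  rintro y ⟨s, hs, h⟩
  exact ⟨s, hH hs, h⟩

/-- Choose a functional f that vanishes on D but not at v. The transvections x ↦ x + f(x)u with u ∈
ker f fix D and send v to the distinct points v + f(v)u. -/
theorem hasLargeOrbits_specialLinear : HasLargeOrbits (specialLinear K V) 2 := by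
  have : FiniteDimensional K V := Module.Finite.of_finite
  refine ⟨⊥, by simp, fun D _ v hv hdim => ?_⟩
  obtain ⟨f, hfv, hf⟩ := Submodule.exists_le_ker_of_notMem hv
  have hker : finrank K V ≤ finrank K (LinearMap.ker f) + 1 := by
    have h1 := LinearMap.finrank_range_add_finrank_ker f
    have h2 := Submodule.finrank_le (LinearMap.range f)
    rw [finrank_self] at h2
    omega
  refine pow_finrank_le_mul_ncard (LinearMap.ker f) (fun u => v + f v • u) _ 0 ?_ ?_ _ _ (by omega)
  · intro u hu
    refine ⟨LinearEquiv.transvection (LinearMap.mem_ker.1 hu), ?_, ?_, ?_⟩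
    · exact LinearEquiv.transvection.det_eq_one _
    · intro x hx
      rw [LinearEquiv.transvection.apply, LinearMap.mem_ker.1 (hf hx), zero_smul, add_zero]
    · rw [LinearEquiv.transvection.apply]
  · intro y _ y' _ h
    refine ⟨0, ?_⟩
    have := smul_right_injective V hfv (add_left_cancel h)
    simpa using this.symm

end Counting

/-! ### Orthogonal complements, the symplectic group, Eichler transformations -/

section Forms

open Module

variable {K V : Type*} [Field K] [AddCommGroup V] [Module K V] {σ : K →+* K}

/-- The subspace orthogonal to `D` with respect to a sesquilinear form. -/
def formPerp (B : V →ₛₗ[σ] V →ₗ[K] K) (D : Submodule K V) : Submodule K V where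
  carrier := {x | ∀ d ∈ D, B d x = 0}
  zero_mem' := by simp
  add_mem' := by
    intro a b ha hb d hd
    rw [map_add, ha d hd, hb d hd, add_zero]
  smul_mem' := by
    intro c a ha d hd
    rw [map_smul, ha d hd, smul_zero]

theorem finrank_le_finrank_add_finrank_formPerp [FiniteDimensional K V] (B : V →ₛₗ[σ] V →ₗ[K] K)
    (D : Submodule K V) : finrank K V ≤ finrank K D + finrank K (formPerp B D) := by
  let b := Module.finBasis K D
  let L : V →ₗ[K] (Fin (finrank K D) → K) := LinearMap.pi fun i => B (b i)
  have h1 := LinearMap.finrank_range_add_finrank_ker L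
  have h2 := Submodule.finrank_le (LinearMap.range L)
  rw [finrank_fin_fun] at h2
  have h3 : LinearMap.ker L ≤ formPerp B D := by
    intro x hx d hd
    have hx' : ∀ i, B (b i) x = 0 := fun i => congrFun (LinearMap.mem_ker.1 hx) i
    have hd' : d = ∑ i, b.repr ⟨d, hd⟩ i • (b i : V) := by
      have := congrArg Subtype.val (b.sum_repr ⟨d, hd⟩)
      simp only [Submodule.coe_sum, Submodule.coe_smul] at this
      exact this.symm
    rw [hd', map_sum, LinearMap.sum_apply]
    refine Finset.sum_eq_zero fun i _ => ?_
    rw [LinearMap.map_smulₛₗ, LinearMap.smul_apply, hx' i, smul_zero]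
  have h4 := Submodule.finrank_mono h3
  omega

theorem finrank_le_finrank_inf_add [FiniteDimensional K V] (W : Submodule K V)
    (B : V →ₛₗ[σ] V →ₗ[K] K) (u : V) :
    finrank K W ≤ finrank K (W ⊓ formPerp B (K ∙ u) : Submodule K V) + 1 := by
  have h1 := finrank_le_finrank_add_finrank_formPerp B (K ∙ u)
  have h2 := Submodule.finrank_sup_add_finrank_inf_eq W (formPerp B (K ∙ u))
  have h3 := Submodule.finrank_le (W ⊔ formPerp B (K ∙ u))
  have h4 : finrank K (K ∙ u) ≤ 1 := (finrank_span_le_card {u}).trans (by simp)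
  omega

theorem mem_formPerp_span_singleton {B : V →ₛₗ[σ] V →ₗ[K] K} {u x : V} :
    x ∈ formPerp B (K ∙ u) ↔ B u x = 0 := by
  constructor
  · intro h
    exact h u (Submodule.mem_span_singleton_self u)
  · intro h d hd
    obtain ⟨c, rfl⟩ := Submodule.mem_span_singleton.1 hd
    rw [LinearMap.map_smulₛₗ, LinearMap.smul_apply, h, smul_zero]

theorem exists_isCompl_inf [FiniteDimensional K V] (W D : Submodule K V) :
    ∃ C : Submodule K V, Disjoint D C ∧
      finrank K W ≤ finrank K (W ⊓ C : Submodule K V) + finrank K D := by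
  obtain ⟨C, hC⟩ := Submodule.exists_isCompl D
  refine ⟨C, hC.disjoint, ?_⟩
  have h1 := Submodule.finrank_add_eq_of_isCompl hC
  have h2 := Submodule.finrank_sup_add_finrank_inf_eq W C
  have h3 := Submodule.finrank_le (W ⊔ C)
  omega

variable {B : V →ₛₗ[σ] V →ₗ[K] K} {R : Submodule K V}

/-- A functional separating v from D vanishes on R ≤ D, so the form represents it. Allowing R
accommodates polar forms with a radical. -/
theorem exists_mem_formPerp_ne (hrefl : ∀ x y, B x y = 0 → B y x = 0)
    (hrep : ∀ f : V →ₗ[K] K, (∀ x ∈ R, f x = 0) → ∃ z, B z = f) {D : Submodule K V} (hD : R ≤ D)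
    {v : V} (hv : v ∉ D) : ∃ z ∈ formPerp B D, B v z ≠ 0 := by
  obtain ⟨f, hfv, hf⟩ := Submodule.exists_le_ker_of_notMem hv
  obtain ⟨z, rfl⟩ := hrep f fun x hx => hf (hD hx)
  exact ⟨z, fun d hd => hrefl _ _ (hf hd), fun h => hfv (hrefl _ _ h)⟩

/-- There are isotropic vectors orthogonal to a small subspace but not to a given vector. -/
theorem exists_isotropic_mem_formPerp [FiniteDimensional K V]
    (hrefl : ∀ x y, B x y = 0 → B y x = 0)
    (hrep : ∀ f : V →ₗ[K] K, (∀ x ∈ R, f x = 0) → ∃ z, B z = f) (I : V → Prop)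
    (hex : ∀ W : Submodule K V, 3 ≤ finrank K W → ∃ u ∈ W, u ≠ 0 ∧ I u)
    (hI : ∀ u p, I u → B u p ≠ 0 → ∃ α : K, I (p + α • u))
    {D : Submodule K V} (hD : R ≤ D) {v : V} (hv : v ∉ D)
    (hdim : 2 * finrank K D + 3 ≤ finrank K V) :
    ∃ u ∈ formPerp B D, I u ∧ B v u ≠ 0 := by
  obtain ⟨z, hz, hvz⟩ := exists_mem_formPerp_ne hrefl hrep hD hv
  obtain ⟨C, hC, hCr⟩ := exists_isCompl_inf (formPerp B D) D
  have h1 := finrank_le_finrank_add_finrank_formPerp B D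
  obtain ⟨u, ⟨huW, huC⟩, hu0, huI⟩ := hex (formPerp B D ⊓ C) (by omega)
  by_cases hvu : B v u = 0
  -- The isotropic u found so far is orthogonal to v. It is repaired by a p ∈ D^⊥ pairing
  -- non-trivially with both u and v: some p + αu is isotropic, and it pairs with v as p does.
  · have huD : u ∉ D := fun h => hu0 (Submodule.disjoint_def.1 hC u h huC)
    obtain ⟨z', hz', huz'⟩ := exists_mem_formPerp_ne hrefl hrep hD huD
    obtain ⟨p, hp, hvp, hup⟩ : ∃ p ∈ formPerp B D, B v p ≠ 0 ∧ B u p ≠ 0 := by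
      by_cases h2 : B u z = 0
      · by_cases h3 : B v z' = 0
        · exact ⟨z + z', Submodule.add_mem _ hz hz', by rwa [map_add, h3, add_zero],
            by rwa [map_add, h2, zero_add]⟩
        · exact ⟨z', hz', h3, huz'⟩
      · exact ⟨z, hz, hvz, h2⟩
    obtain ⟨α, hα⟩ := hI u p huI hup
    exact ⟨p + α • u, Submodule.add_mem _ hp (Submodule.smul_mem _ _ huW), hα,
      by rwa [map_add, map_smul, hvu, smul_zero, add_zero]⟩
  · exact ⟨u, huW, huI, hvu⟩

/-- A non-degenerate form over a finite field represents all functionals. -/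
theorem exists_form_eq [Finite K] [Finite V] (hB : B.SeparatingLeft) (f : V →ₗ[K] K) :
    ∃ z, B z = f := by
  have : FiniteDimensional K V := Module.Finite.of_finite
  have hinj : Function.Injective B := by
    intro x y h
    rw [← sub_eq_zero]
    refine hB _ fun z => ?_
    rw [map_sub, h, sub_self, LinearMap.zero_apply]
  -- Since `B` is only semilinear, surjectivity is obtained by counting; `e` just shows that V and
  -- its dual are equally large.
  let e : V ≃ₗ[K] Dual K V := LinearEquiv.ofFinrankEq _ _ Subspace.dual_finrank_eq.symm
  exact ((Finite.injective_iff_surjective_of_equiv e.toEquiv).1 hinj) f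

/-- Use symplectic transvections in the directions z + y, where z ∈ D^⊥ is fixed with B z v ≠ 0 and
y ranges over D^⊥ ∩ v^⊥. They send v to the distinct points v + B(z, v)(z + y). -/
theorem hasLargeOrbits_symplectic [Finite K] [Finite V] {B : LinearMap.BilinForm K V}
    (halt : B.IsAlt) (hB : B.Nondegenerate) : HasLargeOrbits (isometries B) 2 := by
  have : FiniteDimensional K V := Module.Finite.of_finite
  have hneg : ∀ x y, B x y = -B y x := fun x y => (halt.neg_eq y x).symm
  have hrefl : ∀ x y, B x y = 0 → B y x = 0 := fun x y h => by rw [hneg, h, neg_zero]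
  refine ⟨⊥, by simp, fun D hD v hv hdim => ?_⟩
  obtain ⟨z, hz, hvz⟩ := exists_mem_formPerp_ne hrefl (fun f _ => exists_form_eq hB.1 f) hD hv
  have h1 := finrank_le_finrank_add_finrank_formPerp B D
  have h2 := finrank_le_finrank_inf_add (formPerp B D) B v
  refine pow_finrank_le_mul_ncard (formPerp B D ⊓ formPerp B (K ∙ v))
    (fun y => v + B z v • (z + y)) _ 0 ?_ ?_ _ _ (by omega)
  · rintro y ⟨hyD, hyv⟩
    have hyv : B y v = 0 := hrefl _ _ (mem_formPerp_span_singleton.1 hyv)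
    refine ⟨LinearEquiv.transvection (f := B (z + y)) (v := z + y) (halt _), ?_, ?_, ?_⟩
    · intro x x'
      simp only [LinearEquiv.transvection.apply, map_add, map_smul, LinearMap.add_apply,
        LinearMap.smul_apply, smul_eq_mul]
      rw [hneg x z, hneg x y, hneg y z, halt.self_eq_zero z, halt.self_eq_zero y]
      ring
    · intro x hx
      rw [LinearEquiv.transvection.apply, hrefl _ _ ((Submodule.add_mem _ hz hyD) x hx), zero_smul,
        add_zero]
    · rw [LinearEquiv.transvection.apply, map_add, LinearMap.add_apply, hyv, add_zero]
  · intro y _ y' _ h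
    refine ⟨0, ?_⟩
    have hzv : B z v ≠ 0 := fun h => hvz (hrefl _ _ h)
    have := add_left_cancel (smul_right_injective V hzv (add_left_cancel h))
    simpa using this.symm

/-- Bounds the fibres when v is moved by Eichler transformations: the image of v determines y modulo
the line of u. -/
theorem exists_eq_add_smul_of_add_smul_sub_smul_eq {a b b' : K} (ha : a ≠ 0) {v y y' u : V}
    (h : v + a • y - b • u = v + a • y' - b' • u) : ∃ c : K, y' = y + c • u := by
  refine ⟨a⁻¹ * (b' - b), ?_⟩
  have h1 : a • y' = a • y + (b' - b) • u := by
    rw [← add_right_inj v, sub_eq_iff_eq_add.1 h.symm]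
    module
  rw [← inv_smul_smul₀ ha y', h1, smul_add, inv_smul_smul₀ ha, mul_smul]

/-- The transformation `x ↦ x + φ(x) y - ψ(x) u - μ φ(x) u`, a product of transvections. -/
def eichler {φ ψ : Dual K V} {u y : V} (μ : K) (hφu : φ u = 0) (hφy : φ y = 0) (hψu : ψ u = 0) :
    V ≃ₗ[K] V :=
  LinearEquiv.transvection hφy *
    LinearEquiv.transvection (f := ψ) (v := -u) (by rw [map_neg, hψu, neg_zero]) *
    LinearEquiv.transvection (f := φ) (v := -(μ • u))
      (by rw [map_neg, map_smul, hφu, smul_zero, neg_zero])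

theorem eichler_apply {φ ψ : Dual K V} {u y : V} (μ : K) (hφu : φ u = 0) (hφy : φ y = 0)
    (hψu : ψ u = 0) (x : V) :
    eichler μ hφu hφy hψu x = x + φ x • y - (ψ x + μ * φ x) • u := by
  simp only [eichler, LinearEquiv.mul_apply, LinearEquiv.transvection.apply, map_add, map_smul,
    map_neg, hφu, hψu]
  module

theorem eichler_mem_specialLinear {φ ψ : Dual K V} {u y : V} (μ : K) (hφu : φ u = 0)
    (hφy : φ y = 0) (hψu : ψ u = 0) : eichler μ hφu hφy hψu ∈ specialLinear K V := by
  unfold eichler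
  refine mul_mem (mul_mem ?_ ?_) ?_ <;> exact LinearEquiv.transvection.det_eq_one _

end Forms

/-! ### The unitary group -/

section Unitary

open Module

variable {K V : Type*} [Field K] [AddCommGroup V] [Module K V] {σ : K →+* K} {q : ℕ}

/-- The polynomial X^q + X of degree q < |K| is non-zero somewhere; dividing by such a trace, which
σ fixes, gives τ. It replaces the factor 1/2 in every characteristic. -/
theorem exists_add_pow_eq_one [Finite K] (hK : Nat.card K = q ^ 2) (hσ : ∀ a, σ a = a ^ q) :
    ∃ τ : K, τ + σ τ = 1 := by
  have := Fintype.ofFinite K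
  have hK' : Fintype.card K = q ^ 2 := by rw [← Nat.card_eq_fintype_card, hK]
  have hq : 1 < q := by
    have : 1 < Nat.card K := Finite.one_lt_card
    rw [hK] at this
    nlinarith
  obtain ⟨t, ht⟩ : ∃ t : K, t + σ t ≠ 0 := by
    have hdeg : (Polynomial.X ^ q + Polynomial.X : Polynomial K).natDegree = q := by
      rw [Polynomial.natDegree_add_eq_left_of_natDegree_lt] <;> simp [hq]
    obtain ⟨t, ht⟩ := Polynomial.exists_eval_ne_zero_of_natDegree_lt_card
      (Polynomial.X ^ q + Polynomial.X : Polynomial K) (by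
        intro h
        rw [h, Polynomial.natDegree_zero] at hdeg
        omega) (by
        rw [hdeg, Cardinal.mk_fintype, hK']
        exact_mod_cast (by nlinarith : q < q ^ 2))
    refine ⟨t, ?_⟩
    rw [hσ, add_comm]
    simpa using ht
  have hfix : σ (t + σ t) = t + σ t := by
    rw [map_add, hσ (σ t), hσ t, ← pow_mul, ← sq, ← hK', FiniteField.pow_card, add_comm]
  refine ⟨t / (t + σ t), ?_⟩
  rw [map_div₀, hfix, ← add_div, div_self ht]

/-- Surjectivity of the norm: in the cyclic group of order (q - 1)(q + 1), an element killed by q -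
1 is a (q + 1)-th power. -/
theorem exists_mul_pow_eq [Finite K] (hK : Nat.card K = q ^ 2) (hσ : ∀ a, σ a = a ^ q) {e : K}
    (he : σ e = e) (he0 : e ≠ 0) : ∃ t : K, σ t * t = e := by
  have hq : 1 < q := by
    have : 1 < Nat.card K := Finite.one_lt_card
    rw [hK] at this
    nlinarith
  obtain ⟨g, hg⟩ := IsCyclic.exists_generator (α := Kˣ)
  have hord : orderOf g = (q - 1) * (q + 1) := by
    rw [orderOf_eq_card_of_forall_mem_zpowers hg, Nat.card_units, hK]
    obtain ⟨p, rfl⟩ : ∃ p, q = p + 1 := ⟨q - 1, by omega⟩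
    have : (p + 1) ^ 2 = p * (p + 1 + 1) + 1 := by ring
    rw [Nat.add_sub_cancel, this, Nat.add_sub_cancel]
  obtain ⟨k, hk⟩ := (mem_powers_iff_mem_zpowers.2 (hg (Units.mk0 e he0)))
  have hk : g ^ k = Units.mk0 e he0 := hk
  have h1 : g ^ (k * (q - 1)) = 1 := by
    rw [pow_mul, hk]
    have h2 : (Units.mk0 e he0) ^ (q - 1) * Units.mk0 e he0 = Units.mk0 e he0 := by
      rw [← pow_succ, Nat.sub_add_cancel hq.le]
      ext
      rw [Units.val_pow_eq_pow_val, Units.val_mk0, ← hσ, he]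
    exact mul_eq_right.1 h2
  have h3 := orderOf_dvd_of_pow_eq_one h1
  rw [hord, mul_comm] at h3
  obtain ⟨j, rfl⟩ := Nat.dvd_of_mul_dvd_mul_right (by omega) h3
  refine ⟨(g ^ j : Kˣ), ?_⟩
  rw [hσ, ← pow_succ, ← Units.val_pow_eq_pow_val, ← pow_mul, mul_comm, hk, Units.val_mk0]

/-- With u ∈ D^⊥ isotropic and B v u ≠ 0, each y ∈ D^⊥ ∩ u^⊥ gives an Eichler transformation that
fixes D. The coefficient τ B(y, y) makes it an isometry because τ + σ τ = 1. -/
theorem hasLargeOrbits_unitary [Finite K] [Finite V] (hK : Nat.card K = q ^ 2)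
    (hσ : ∀ a, σ a = a ^ q) {B : V →ₛₗ[σ] V →ₗ[K] K} (hherm : ∀ x y, B y x = σ (B x y))
    (hB : B.Nondegenerate) : HasLargeOrbits (isometries B ⊓ specialLinear K V) 3 := by
  have : FiniteDimensional K V := Module.Finite.of_finite
  have hrefl : ∀ x y, B x y = 0 → B y x = 0 := fun x y h => by rw [hherm, h, map_zero]
  obtain ⟨τ, hτ⟩ := exists_add_pow_eq_one hK hσ
  refine ⟨⊥, by simp, fun D hD v hv hdim => ?_⟩
  obtain ⟨u, huD, huI, hvu⟩ : ∃ u ∈ formPerp B D, B u u = 0 ∧ B v u ≠ 0 := by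
    refine exists_isotropic_mem_formPerp hrefl (fun f _ => exists_form_eq hB.1 f)
      (fun u => B u u = 0) ?_ ?_ hD hv (by omega)
    · intro W hW
      obtain ⟨x, hxW, hx0⟩ := W.exists_mem_ne_zero_of_ne_bot (by
        rintro rfl
        rw [finrank_bot] at hW
        omega)
      by_cases hxx : B x x = 0
      · exact ⟨x, hxW, hx0, hxx⟩
      have h1 := finrank_le_finrank_inf_add W B x
      obtain ⟨y, ⟨hyW, hyx⟩, hy0⟩ := (W ⊓ formPerp B (K ∙ x)).exists_mem_ne_zero_of_ne_bot (by
        intro h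
        rw [h, finrank_bot] at h1
        omega)
      by_cases hyy : B y y = 0
      · exact ⟨y, hyW, hy0, hyy⟩
      have hxy : B x y = 0 := mem_formPerp_span_singleton.1 hyx
      have hyx : B y x = 0 := hrefl _ _ hxy
      obtain ⟨t, ht⟩ := exists_mul_pow_eq hK hσ (e := -B x x / B y y)
        (by rw [map_div₀, map_neg, ← hherm, ← hherm]) (div_ne_zero (neg_ne_zero.2 hxx) hyy)
      refine ⟨x + t • y, Submodule.add_mem _ hxW (Submodule.smul_mem _ _ hyW), ?_, ?_⟩
      · intro h
        apply hxx
        have := congrArg (B x) h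
        simpa [hxy] using this
      · simp only [map_add, map_smul, LinearMap.map_smulₛₗ, LinearMap.add_apply,
          LinearMap.smul_apply, smul_eq_mul, hxy, hyx, mul_zero, add_zero, zero_add]
        rw [← mul_assoc, mul_comm t, ht, div_mul_cancel₀ _ hyy, add_neg_cancel]
    · intro u p hu hup
      have hpu : B p u ≠ 0 := fun h => hup (hrefl _ _ h)
      refine ⟨-(τ * B p p) / B p u, ?_⟩
      have h1 : -(τ * B p p) / B p u * B p u = -(τ * B p p) := div_mul_cancel₀ _ hpu
      have h2 : σ (-(τ * B p p) / B p u) * B u p = -(σ τ * B p p) := by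
        rw [hherm p u, ← map_mul, h1, map_neg, map_mul, ← hherm]
      simp only [map_add, map_smul, LinearMap.map_smulₛₗ, LinearMap.add_apply,
        LinearMap.smul_apply, smul_eq_mul, hu, mul_zero, add_zero]
      rw [h1, h2]
      linear_combination (-B p p) * hτ
  have huv : B u v ≠ 0 := fun h => hvu (hrefl _ _ h)
  have h1 := finrank_le_finrank_add_finrank_formPerp B D
  have h2 := finrank_le_finrank_inf_add (formPerp B D) B u
  refine pow_finrank_le_mul_ncard (formPerp B D ⊓ formPerp B (K ∙ u))
    (fun y => v + B u v • y - (B y v + τ * B y y * B u v) • u) _ u ?_ ?_ _ _ (by omega)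
  · rintro y ⟨hyD, hyu⟩
    have hyu : B u y = 0 := mem_formPerp_span_singleton.1 hyu
    refine ⟨eichler (φ := B u) (ψ := B y) (τ * B y y) huI hyu (hrefl _ _ hyu),
      ⟨?_, eichler_mem_specialLinear _ _ _ _⟩, ?_, ?_⟩
    · intro x x'
      simp only [eichler_apply, map_add, map_sub, map_smul, LinearMap.map_smulₛₗ,
        LinearMap.add_apply, LinearMap.sub_apply, LinearMap.smul_apply, smul_eq_mul, map_mul,
        hyu, hrefl _ _ hyu, huI]
      rw [hherm u x, hherm y x, ← hherm y y]
      linear_combination (- σ (B u x) * B u x' * B y y) * hτ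
    · intro x hx
      rw [eichler_apply, hrefl _ _ (huD x hx), hrefl _ _ (hyD x hx)]
      simp
    · rw [eichler_apply]
  · intro y _ y' _ h
    exact exists_eq_add_smul_of_add_smul_sub_smul_eq huv h

end Unitary

/-! ### The orthogonal group in every characteristic -/

section Orthogonal

open Module

variable {K V : Type*} [Field K] [AddCommGroup V] [Module K V] {Q : QuadraticForm K V}

theorem map_add_smul (Q : QuadraticForm K V) (x y : V) (c : K) :
    Q (x + c • y) = Q x + c * c * Q y + c * QuadraticMap.polar Q x y := by
  have h : QuadraticMap.polar Q x (c • y) = c * QuadraticMap.polar Q x y := by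
    rw [QuadraticMap.polar_smul_right, smul_eq_mul]
  have h2 := QuadraticMap.map_add Q x (c • y)
  rw [h, QuadraticMap.map_smul, smul_eq_mul] at h2
  exact h2

/-- A quadratic form in at least three variables over a finite field has a non-trivial zero. -/
theorem exists_singular_mem [Finite K] [FiniteDimensional K V] (Q : QuadraticForm K V)
    (W : Submodule K V) (hW : 3 ≤ finrank K W) : ∃ u ∈ W, u ≠ 0 ∧ Q u = 0 := by
  have := Fintype.ofFinite K
  let B : LinearMap.BilinForm K V := QuadraticMap.polarBilin Q
  have hB : ∀ x y, QuadraticMap.polar Q x y = B x y := fun x y => rfl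
  have hsymm : ∀ x y, B x y = B y x := fun x y => QuadraticMap.polar_comm Q x y
  have hself : ∀ x, B x x = 2 * Q x := fun x => by
    rw [← hB, QuadraticMap.polar_self, nsmul_eq_mul, Nat.cast_ofNat]
  obtain ⟨x, hxW, hx0⟩ := W.exists_mem_ne_zero_of_ne_bot (by
    rintro rfl
    rw [finrank_bot] at hW
    omega)
  by_cases hxx : Q x = 0
  · exact ⟨x, hxW, hx0, hxx⟩
  have h1 := finrank_le_finrank_inf_add W B x
  -- In characteristic 2 every scalar is a square, so two independent orthogonal vectors suffice; as
  -- x lies in its own complement, y must be chosen off its line. Otherwise three orthogonal vectors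
  -- give a diagonal ternary form, which has a zero.
  by_cases hchar : ringChar K = 2
  · have h2 : (2 : K) = 0 := by
      have := ringChar.Nat.cast_ringChar (R := K)
      rwa [hchar, Nat.cast_ofNat] at this
    obtain ⟨y, hyW, hyx⟩ : ∃ y ∈ W ⊓ formPerp B (K ∙ x), y ∉ K ∙ x := by
      by_contra! hcon
      have h3 := Submodule.finrank_mono (show W ⊓ formPerp B (K ∙ x) ≤ K ∙ x from hcon)
      have h4 : finrank K (K ∙ x) ≤ 1 := (finrank_span_le_card {x}).trans (by simp)
      omega
    have hxy : B x y = 0 := mem_formPerp_span_singleton.1 hyW.2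
    by_cases hyy : Q y = 0
    · exact ⟨y, hyW.1, fun h => hyx (h ▸ Submodule.zero_mem _), hyy⟩
    obtain ⟨t, ht⟩ := FiniteField.isSquare_of_char_two hchar (-Q x / Q y)
    refine ⟨x + t • y, Submodule.add_mem _ hxW (Submodule.smul_mem _ _ hyW.1), ?_, ?_⟩
    · intro h
      rcases eq_or_ne t 0 with rfl | ht0
      · rw [zero_smul, add_zero] at h
        exact hx0 h
      · apply hyx
        have h3 : y = t⁻¹ • (-x) := by
          rw [← inv_smul_smul₀ ht0 y, eq_neg_of_add_eq_zero_right h]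
        rw [h3]
        exact Submodule.smul_mem _ _ (Submodule.neg_mem _ (Submodule.mem_span_singleton_self x))
    · rw [map_add_smul, hB, hxy, ← ht, div_mul_cancel₀ _ hyy]
      ring
  · have h2 : (2 : K) ≠ 0 := Ring.two_ne_zero hchar
    obtain ⟨y, ⟨hyW, hyx⟩, hy0⟩ := (W ⊓ formPerp B (K ∙ x)).exists_mem_ne_zero_of_ne_bot (by
      intro h
      rw [h, finrank_bot] at h1
      omega)
    have hxy : B x y = 0 := mem_formPerp_span_singleton.1 hyx
    by_cases hyy : Q y = 0
    · exact ⟨y, hyW, hy0, hyy⟩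
    have h3 := finrank_le_finrank_inf_add (W ⊓ formPerp B (K ∙ x)) B y
    obtain ⟨z, ⟨⟨hzW, hzx⟩, hzy⟩, hz0⟩ :=
      ((W ⊓ formPerp B (K ∙ x)) ⊓ formPerp B (K ∙ y)).exists_mem_ne_zero_of_ne_bot (by
      intro h
      rw [h, finrank_bot] at h3
      omega)
    have hzx : B z x = 0 := by rw [hsymm]; exact mem_formPerp_span_singleton.1 hzx
    have hzy : B z y = 0 := by rw [hsymm]; exact mem_formPerp_span_singleton.1 hzy
    by_cases hzz : Q z = 0
    · exact ⟨z, hzW, hz0, hzz⟩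
    obtain ⟨α, β, hαβ⟩ := FiniteField.exists_root_sum_quadratic
      (f := Polynomial.C (Q x) * Polynomial.X ^ 2)
      (g := Polynomial.C (Q y) * Polynomial.X ^ 2 + Polynomial.C (Q z))
      (Polynomial.degree_C_mul_X_pow 2 hxx) (by
        rw [Polynomial.degree_add_C (by rw [Polynomial.degree_C_mul_X_pow 2 hyy]; norm_num),
          Polynomial.degree_C_mul_X_pow 2 hyy]
        rfl) (FiniteField.odd_card_of_char_ne_two hchar)
    simp only [Polynomial.eval_add, Polynomial.eval_mul, Polynomial.eval_C, Polynomial.eval_pow,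
      Polynomial.eval_X] at hαβ
    refine ⟨z + α • x + β • y, Submodule.add_mem _ (Submodule.add_mem _ hzW
      (Submodule.smul_mem _ _ hxW)) (Submodule.smul_mem _ _ hyW), ?_, ?_⟩
    · intro h
      apply hzz
      have := congrArg (B z) h
      simp only [map_add, map_smul, hzx, hzy, smul_zero, add_zero, map_zero, hself] at this
      exact (mul_eq_zero.1 this).resolve_left h2
    · rw [map_add_smul, map_add_smul, hB, hB, hzx]
      simp only [map_add, map_smul, LinearMap.add_apply, LinearMap.smul_apply, smul_eq_mul, hzy,
        hxy]
      linear_combination hαβ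

/-- By symmetry the represented functionals annihilate the radical, and rank-nullity shows that they
fill its annihilator. -/
theorem exists_polarBilin_eq [FiniteDimensional K V] (f : Dual K V)
    (hf : ∀ x ∈ LinearMap.ker (QuadraticMap.polarBilin Q), f x = 0) :
    ∃ z, QuadraticMap.polarBilin Q z = f := by
  set B : LinearMap.BilinForm K V := QuadraticMap.polarBilin Q with hB
  have hsymm : ∀ x y, B x y = B y x := fun x y => QuadraticMap.polar_comm Q x y
  have h1 : LinearMap.range B ≤ (LinearMap.ker B).dualAnnihilator := by
    rintro _ ⟨z, rfl⟩
    rw [Submodule.mem_dualAnnihilator]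
    intro x hx
    rw [hsymm, LinearMap.mem_ker.1 hx, LinearMap.zero_apply]
  have h2 : LinearMap.range B = (LinearMap.ker B).dualAnnihilator := by
    refine Submodule.eq_of_le_of_finrank_eq h1 ?_
    have h3 := LinearMap.finrank_range_add_finrank_ker B
    have h4 := Subspace.finrank_add_finrank_dualAnnihilator_eq (LinearMap.ker B)
    exact Nat.add_left_cancel ((add_comm _ _).trans (h3.trans h4.symm))
  have h3 : f ∈ LinearMap.range B := by
    rw [h2, Submodule.mem_dualAnnihilator]
    exact hf
  exact h3

/-- A radical of dimension 3 would contain a non-zero singular vector. The radical serves as the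
exceptional space R of `HasLargeOrbits`. -/
theorem finrank_ker_polarBilin_le [Finite K] [FiniteDimensional K V]
    (hQ : NondegenerateQuadratic Q) :
    finrank K (LinearMap.ker (QuadraticMap.polarBilin Q)) ≤ 2 := by
  by_contra! h
  obtain ⟨u, hu, hu0, huQ⟩ := exists_singular_mem Q _ h
  exact hu0 (hQ u huQ fun y => LinearMap.congr_fun (LinearMap.mem_ker.1 hu) y)

variable {u : V}

/-- The Eichler transformation attached to a singular vector `u` and a vector `y` orthogonal to
`u`. -/
def quadraticEichler (Q : QuadraticForm K V) {u y : V} (hu : Q u = 0)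
    (huy : QuadraticMap.polarBilin Q u y = 0) : V ≃ₗ[K] V :=
  eichler (φ := QuadraticMap.polarBilin Q u) (ψ := QuadraticMap.polarBilin Q y) (u := u) (y := y)
    (Q y) (by
      change QuadraticMap.polar Q u u = 0
      rw [QuadraticMap.polar_self, hu, smul_zero]) huy
    ((QuadraticMap.polar_comm Q y u).trans huy)

theorem quadraticEichler_apply {y : V} (hu : Q u = 0) (huy : QuadraticMap.polarBilin Q u y = 0)
    (x : V) : quadraticEichler Q hu huy x = x + QuadraticMap.polarBilin Q u x • y -
      (QuadraticMap.polarBilin Q y x + Q y * QuadraticMap.polarBilin Q u x) • u :=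
  eichler_apply _ _ _ _ _

theorem quadraticEichler_mem_orthogonal {y : V} (hu : Q u = 0)
    (huy : QuadraticMap.polarBilin Q u y = 0) : quadraticEichler Q hu huy ∈ orthogonal Q := by
  intro x
  set B : LinearMap.BilinForm K V := QuadraticMap.polarBilin Q with hB
  have hpol : ∀ x y, QuadraticMap.polar Q x y = B x y := fun x y => rfl
  have hsymm : ∀ x y, B x y = B y x := fun x y => QuadraticMap.polar_comm Q x y
  rw [quadraticEichler_apply, ← hB, sub_eq_add_neg, ← neg_smul, map_add_smul, map_add_smul, hu,
    hpol, hpol]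
  simp only [map_add, map_smul, LinearMap.add_apply, LinearMap.smul_apply, smul_eq_mul]
  rw [hsymm y u, huy, hsymm x u, hsymm x y]
  ring

/-- The reflection in a non-singular vector. -/
def quadraticReflection (Q : QuadraticForm K V) {a : V} (ha : Q a ≠ 0) : V ≃ₗ[K] V :=
  Module.reflection (f := (Q a)⁻¹ • QuadraticMap.polarBilin Q a) (x := a) (by
    change (Q a)⁻¹ * QuadraticMap.polar Q a a = 2
    rw [QuadraticMap.polar_self, nsmul_eq_mul, mul_left_comm, inv_mul_cancel₀ ha, mul_one,
      Nat.cast_ofNat])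

theorem quadraticReflection_apply {a : V} (ha : Q a ≠ 0) (x : V) :
    quadraticReflection Q ha x = x - ((Q a)⁻¹ * QuadraticMap.polarBilin Q a x) • a :=
  Module.reflection_apply _ _

theorem quadraticReflection_mem_orthogonal {a : V} (ha : Q a ≠ 0) :
    quadraticReflection Q ha ∈ orthogonal Q := by
  intro x
  have hsymm : QuadraticMap.polar Q x a = QuadraticMap.polarBilin Q a x :=
    QuadraticMap.polar_comm Q x a
  rw [quadraticReflection_apply, sub_eq_add_neg, ← neg_smul, map_add_smul, hsymm]
  field_simp
  ring

/-- Eichler transformations along a non-singular vector are commutators. -/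
theorem quadraticEichler_mem_commutator_of_ne {a y : V} (hu : Q u = 0)
    (hua : QuadraticMap.polarBilin Q u a = 0) (huy : QuadraticMap.polarBilin Q u y = 0)
    (ha : Q a ≠ 0) (hay : QuadraticMap.polarBilin Q a y = Q a) :
    quadraticEichler Q hu hua ∈ ⁅orthogonal Q, orthogonal Q⁆ := by
  -- Write E_y for the Eichler map and r for the reflection in a. As r fixes u and sends y to y - a,
  -- conjugating E_y by r gives E_(y-a), and E_y times the inverse of E_(y-a) is E_a.
  have key : quadraticEichler Q hu hua =
      quadraticEichler Q hu huy * quadraticReflection Q ha * (quadraticEichler Q hu huy)⁻¹ *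
        (quadraticReflection Q ha)⁻¹ := by
    rw [eq_mul_inv_iff_mul_eq, eq_mul_inv_iff_mul_eq]
    ext x
    set B : LinearMap.BilinForm K V := QuadraticMap.polarBilin Q with hB
    have hsymm : ∀ x y, B x y = B y x := fun x y => QuadraticMap.polar_comm Q x y
    have hself : ∀ x, B x x = 2 * Q x := fun x => by
      change QuadraticMap.polar Q x x = _
      rw [QuadraticMap.polar_self, nsmul_eq_mul, Nat.cast_ofNat]
    simp only [LinearEquiv.mul_apply, quadraticEichler_apply, quadraticReflection_apply, ← hB,
      map_add, map_sub, map_smul, hsymm y a, hsymm a u, hua, huy, hay, hself, hu]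
    match_scalars <;> field_simp <;> ring
  rw [key]
  exact Subgroup.commutator_mem_commutator (quadraticEichler_mem_orthogonal _ _)
    (quadraticReflection_mem_orthogonal _)

theorem quadraticEichler_mul {a b : V} (hu : Q u = 0)
    (hua : QuadraticMap.polarBilin Q u a = 0) (hub : QuadraticMap.polarBilin Q u b = 0)
    (huab : QuadraticMap.polarBilin Q u (a + b) = 0) :
    quadraticEichler Q hu huab = quadraticEichler Q hu hua * quadraticEichler Q hu hub := by
  ext x
  set B : LinearMap.BilinForm K V := QuadraticMap.polarBilin Q with hB
  have hsymm : ∀ x y, B x y = B y x := fun x y => QuadraticMap.polar_comm Q x y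
  have hself : B u u = 0 := by
    change QuadraticMap.polar Q u u = _
    rw [QuadraticMap.polar_self, hu, smul_zero]
  have hadd : Q (a + b) = Q a + Q b + B a b := QuadraticMap.map_add Q a b
  simp only [LinearEquiv.mul_apply, quadraticEichler_apply, ← hB,
    map_add, map_sub, map_smul, LinearMap.add_apply, hsymm a u, hua, hub, hself, hadd]
  match_scalars <;> ring

/-- The orbit argument is the unitary one; the new issue is that the Eichler maps must lie in the
commutator subgroup. Non-singular directions off D₁ are handled directly, singular ones as a
difference of two non-singular ones. -/
theorem hasLargeOrbits_orthogonal [Finite K] [Finite V] (hQ : NondegenerateQuadratic Q) :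
    HasLargeOrbits ⁅orthogonal Q, orthogonal Q⁆ 5 := by
  have : FiniteDimensional K V := Module.Finite.of_finite
  set B : LinearMap.BilinForm K V := QuadraticMap.polarBilin Q with hB
  have hpol : ∀ x y, QuadraticMap.polar Q x y = B x y := fun x y => rfl
  have hsymm : ∀ x y, B x y = B y x := fun x y => QuadraticMap.polar_comm Q x y
  have hrefl : ∀ x y, B x y = 0 → B y x = 0 := fun x y h => by rw [hsymm, h]
  have hrep : ∀ f : V →ₗ[K] K, (∀ x ∈ LinearMap.ker B, f x = 0) → ∃ z, B z = f :=
    exists_polarBilin_eq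
  refine ⟨LinearMap.ker B, finrank_ker_polarBilin_le hQ, fun D hD v hv hdim => ?_⟩
  obtain ⟨u, huD, hu, hvu⟩ : ∃ u ∈ formPerp B D, Q u = 0 ∧ B v u ≠ 0 := by
    refine exists_isotropic_mem_formPerp hrefl hrep (fun u => Q u = 0) (exists_singular_mem Q) ?_
      hD hv (by omega)
    intro u p hu hup
    refine ⟨-Q p / B u p, ?_⟩
    rw [map_add_smul, hpol, hsymm p u, hu, div_mul_cancel₀ _ hup]
    ring
  have huv : B u v ≠ 0 := fun h => hvu (hrefl _ _ h)
  set D₁ := D ⊔ K ∙ u with hD₁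
  have hRD₁ : LinearMap.ker B ≤ D₁ := hD.trans le_sup_left
  have hD₁r : finrank K D₁ ≤ finrank K D + 1 := by
    have h1 := Submodule.finrank_add_le_finrank_add_finrank D (K ∙ u)
    have h2 : finrank K (K ∙ u) ≤ 1 := (finrank_span_le_card {u}).trans (by simp)
    rw [hD₁]
    omega
  have hYD : ∀ y ∈ formPerp B D₁, ∀ x ∈ D, B y x = 0 := fun y hy x hx =>
    hrefl _ _ (hy x (Submodule.mem_sup_left hx))
  have hYu : ∀ y ∈ formPerp B D₁, B u y = 0 := fun y hy =>
    hy u (Submodule.mem_sup_right (Submodule.mem_span_singleton_self u))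
  have hns : ∀ a (ha : a ∈ formPerp B D₁), a ∉ D₁ → Q a ≠ 0 →
      quadraticEichler Q hu (hYu a ha) ∈ ⁅orthogonal Q, orthogonal Q⁆ := by
    intro a ha haD hQa
    obtain ⟨z, hz, haz⟩ := exists_mem_formPerp_ne hrefl hrep hRD₁ haD
    refine quadraticEichler_mem_commutator_of_ne (y := (Q a / B a z) • z) hu (hYu a ha) ?_ hQa ?_
    · rw [map_smul, ← hB, hYu z hz, smul_zero]
    · rw [map_smul, ← hB, smul_eq_mul, div_mul_cancel₀ _ haz]
  have hY := finrank_le_finrank_add_finrank_formPerp B D₁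
  obtain ⟨y₀, hy₀, hy₀D, hQy₀⟩ : ∃ y₀ ∈ formPerp B D₁, y₀ ∉ D₁ ∧ Q y₀ ≠ 0 := by
    obtain ⟨y, hy, hyD⟩ : ∃ y ∈ formPerp B D₁, y ∉ D₁ := by
      by_contra! hcon
      have h3 := Submodule.finrank_mono (show formPerp B D₁ ≤ D₁ from hcon)
      omega
    by_cases hQy : Q y = 0
    · obtain ⟨z, hz, hyz⟩ := exists_mem_formPerp_ne hrefl hrep hRD₁ hyD
      by_cases hQz : Q z = 0
      · refine ⟨y + z, Submodule.add_mem _ hy hz, fun h => hyz ?_, ?_⟩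
        · have h1 := hrefl _ _ (hy _ h)
          have h2 : B y y = 0 := by
            rw [← hpol, QuadraticMap.polar_self, hQy, smul_zero]
          rwa [map_add, h2, zero_add] at h1
        · rw [QuadraticMap.map_add Q, hQy, hQz, zero_add, zero_add]
          exact hyz
      · exact ⟨z, hz, fun h => hyz (hrefl _ _ (hy _ h)), hQz⟩
    · exact ⟨y, hy, hyD, hQy⟩
  -- Restricting to C keeps the directions a and a + y₀ off D₁ where needed. The directions left
  -- have dimension at least n - 2 dim D - 4, which with the line fibres is where the constant 5
  -- comes from.
  obtain ⟨C, hC, hCr⟩ := exists_isCompl_inf (formPerp B D₁ ⊓ formPerp B (K ∙ y₀)) (D₁ ⊔ K ∙ y₀)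
  have hY' := finrank_le_finrank_inf_add (formPerp B D₁) B y₀
  have hD₂ : finrank K (D₁ ⊔ K ∙ y₀ : Submodule K V) ≤ finrank K D₁ + 1 := by
    have h1 := Submodule.finrank_add_le_finrank_add_finrank D₁ (K ∙ y₀)
    have h2 : finrank K (K ∙ y₀) ≤ 1 := (finrank_span_le_card {y₀}).trans (by simp)
    omega
  have hy₀' : y₀ ∈ D₁ ⊔ K ∙ y₀ :=
    Submodule.mem_sup_right (Submodule.mem_span_singleton_self y₀)
  have hmem : ∀ a (ha : a ∈ formPerp B D₁), B y₀ a = 0 → a ∈ C →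
      quadraticEichler Q hu (hYu a ha) ∈ ⁅orthogonal Q, orthogonal Q⁆ := by
    intro a ha hay haC
    by_cases hQa : Q a = 0
    · have h1 : a + y₀ ∉ D₁ := by
        intro h
        have h2 : a ∈ D₁ ⊔ K ∙ y₀ := by
          rw [← add_sub_cancel_right a y₀]
          exact Submodule.sub_mem _ (Submodule.mem_sup_left h) hy₀'
        rw [Submodule.disjoint_def.1 hC a h2 haC, zero_add] at h
        exact hy₀D h
      have h2 : Q (a + y₀) ≠ 0 := by
        rwa [QuadraticMap.map_add Q, hpol, hsymm, hay, hQa, add_zero, zero_add]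
      have h3 := hns (a + y₀) (Submodule.add_mem _ ha hy₀) h1 h2
      rw [quadraticEichler_mul hu (hYu a ha) (hYu y₀ hy₀)] at h3
      exact (Subgroup.mul_mem_cancel_right _ (hns y₀ hy₀ hy₀D hQy₀)).1 h3
    · refine hns a ha (fun h => hQa ?_) hQa
      rw [Submodule.disjoint_def.1 hC a (Submodule.mem_sup_left h) haC, map_zero]
  refine pow_finrank_le_mul_ncard ((formPerp B D₁ ⊓ formPerp B (K ∙ y₀)) ⊓ C)
    (fun y => v + B u v • y - (B y v + Q y * B u v) • u) _ u ?_ ?_ _ _ (by omega)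
  · rintro y ⟨⟨hy, hyy₀⟩, hyC⟩
    refine ⟨quadraticEichler Q hu (hYu y hy),
      hmem y hy (mem_formPerp_span_singleton.1 hyy₀) hyC, ?_, ?_⟩
    · intro x hx
      rw [quadraticEichler_apply, ← hB, hYD y hy x hx, hrefl _ _ (huD x hx)]
      simp
    · rw [quadraticEichler_apply]
  · intro y _ y' _ h
    exact exists_eq_add_smul_of_add_smul_sub_smul_eq huv h

end Orthogonal

/-! ### Centralizers in the linear groups H -/

section LinearGroups

open Module

variable {K V : Type*} [Field K] [AddCommGroup V] [Module K V]

theorem hasLargeOrbits_of_type [Finite K] [Finite V] {q r : ℕ} {H : Subgroup (V ≃ₗ[K] V)}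
    (h : IsLinearType q r H ∨ IsUnitaryType q r H ∨ IsSymplecticType q r H ∨
      IsOrthogonalType q r H) : HasLargeOrbits H 5 := by
  rcases h with ⟨-, -, h⟩ | ⟨hK, -, σ, hσ, B, hB, hB', h, -⟩ | ⟨-, -, B, hB, hB', h, -⟩ |
    ⟨-, -, Q, hQ, h, -⟩
  · exact hasLargeOrbits_specialLinear.mono h (by norm_num)
  · exact (hasLargeOrbits_unitary hK hσ hB hB').mono h (by norm_num)
  · exact (hasLargeOrbits_symplectic hB hB').mono h (by norm_num)
  · exact (hasLargeOrbits_orthogonal hQ).mono h le_rfl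

/-- In all four types |K| ≤ q^2 and dim V ≤ 3r, whence the factor 6. -/
theorem card_pow_finrank_le_of_type [Finite K] {q r : ℕ} (hr : 1 ≤ r) {H : Subgroup (V ≃ₗ[K] V)}
    (h : IsLinearType q r H ∨ IsUnitaryType q r H ∨ IsSymplecticType q r H ∨
      IsOrthogonalType q r H) (M : ℕ) :
    Nat.card K ^ (M * finrank K V) ≤ q ^ (6 * M * r) := by
  have h1 : 0 < Nat.card K := Nat.card_pos
  have h2 : Nat.card K ≤ q ^ 2 ∧ finrank K V ≤ 3 * r := by
    rcases h with ⟨hK, hn, -⟩ | ⟨hK, hn, -⟩ | ⟨hK, hn, -⟩ | ⟨hK, hn, -⟩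
    · exact ⟨by rw [hK] at h1 ⊢; nlinarith, by omega⟩
    · exact ⟨hK.le, by omega⟩
    · exact ⟨by rw [hK] at h1 ⊢; nlinarith, by omega⟩
    · exact ⟨by rw [hK] at h1 ⊢; nlinarith, by omega⟩
  calc _ ≤ Nat.card K ^ (M * (3 * r)) :=
        Nat.pow_le_pow_right h1 (Nat.mul_le_mul_left _ h2.2)
    _ ≤ (q ^ 2) ^ (M * (3 * r)) := Nat.pow_le_pow_left h2.1 _
    _ = _ := by rw [← pow_mul]; ring_nf

theorem card_subgroup_le [Finite K] [Finite V] (H : Subgroup (V ≃ₗ[K] V)) :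
    Nat.card H ≤ Nat.card K ^ (finrank K V * finrank K V) := by
  have : FiniteDimensional K V := Module.Finite.of_finite
  have : Finite (End K V) := Module.finite_of_finite K
  rw [← Module.finrank_linearMap K K V V, ← Module.natCard_eq_pow_finrank (K := K)]
  refine Nat.card_le_card_of_injective (fun h : H => ((h.1 : V →ₗ[K] V) : End K V)) ?_
  intro a b hab
  exact Subtype.ext (LinearEquiv.toLinearMap_injective hab)

/-- Conjugation by a turns the centralizer into that of y, which embeds in the linear commutant;
vanishing on ⊥ is no condition. This disposes of the conjugator of the word. -/
theorem card_centralizer_le [Finite K] [Finite V] {H : Subgroup (V ≃ₗ[K] V)} (a y : H) :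
    Nat.card (Subgroup.centralizer ({a * y * a⁻¹} : Set H)) ≤
      Nat.card K ^ finrank K (commutantVanishing ((y.1 : V →ₗ[K] V) : End K V) ⊥) := by
  have : FiniteDimensional K V := Module.Finite.of_finite
  have : Finite (End K V) := Module.finite_of_finite K
  rw [← Module.natCard_eq_pow_finrank (K := K)]
  refine Nat.card_le_card_of_injective
    (fun c => ⟨(((a⁻¹ * c.1 * a).1 : V →ₗ[K] V) : End K V), ?_, ?_⟩) ?_
  · have h := Subgroup.mem_centralizer_singleton_iff.1 c.2
    have h' : a⁻¹ * c.1 * a * y = y * (a⁻¹ * c.1 * a) := by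
      have := congrArg (fun z => a⁻¹ * z * a) h
      simpa [mul_assoc] using this
    exact congrArg (fun z : H => ((z.1 : V →ₗ[K] V) : End K V)) h'
  · intro v hv
    rw [(Submodule.mem_bot K).1 hv, map_zero]
  · intro c c' h
    have h1 := Subtype.ext (LinearEquiv.toLinearMap_injective (Subtype.mk.inj h))
    exact Subtype.ext (mul_left_cancel (mul_right_cancel h1))

theorem exists_conj_isCyclicallyReduced {d : ℕ} {w : FreeGroup (Fin d)} (hw : w ≠ 1) :
    ∃ (u : FreeGroup (Fin d)) (L : List (Fin d × Bool)), L ≠ [] ∧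
      FreeGroup.IsCyclicallyReduced L ∧ w = u * FreeGroup.mk L * u⁻¹ := by
  have h := FreeGroup.reduceCyclically.conj_conjugator_reduceCyclically w.toWord
  have h' : w = FreeGroup.mk (FreeGroup.reduceCyclically.conjugator w.toWord) *
      FreeGroup.mk (FreeGroup.reduceCyclically w.toWord) *
      (FreeGroup.mk (FreeGroup.reduceCyclically.conjugator w.toWord))⁻¹ := by
    rw [FreeGroup.inv_mk, FreeGroup.mul_mk, FreeGroup.mul_mk, h, FreeGroup.mk_toWord]
  refine ⟨_, _, ?_, FreeGroup.reduceCyclically.isCyclicallyReduced FreeGroup.isReduced_toWord, h'⟩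
  intro h0
  rw [h0, ← FreeGroup.one_eq_mk, mul_one, mul_inv_cancel] at h'
  exact hw h'

theorem card_large_centralizer_mul_le [Finite K] [Finite V] {H : Subgroup (V ≃ₗ[K] V)}
    (hH : HasLargeOrbits H 5) {d : ℕ} (u : FreeGroup (Fin d)) {L : List (Fin d × Bool)}
    (hL : L ≠ []) (hred : FreeGroup.IsCyclicallyReduced L) (D e : ℕ) (hD : 0 < D)
    (he : ∀ Ψ : ℕ, (Ψ ≤ D + D * (D * Nat.card K ^ D) ∧ (D = 1 → Ψ ≤ 1)) →
      (3 * L.length + 16) * finrank K V +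
        (3 * L.length + 16) * D * ((3 * L.length + 16) * Ψ) ≤ e) :
    Nat.card {g : Fin d → H // ¬ Nat.card (Subgroup.centralizer
        ({FreeGroup.lift g (u * FreeGroup.mk L * u⁻¹)} : Set H)) ≤ Nat.card K ^ e} *
      Nat.card K ^ D ≤ Nat.card (Fin d → H) := by
  have : FiniteDimensional K V := Module.Finite.of_finite
  have := Fintype.ofFinite K
  refine le_trans (Nat.mul_le_mul_right _ ?_) (card_exists_large_kernel_mul_le hH hL hred D hD)
  refine Nat.card_mono (Set.toFinite {g : Fin d → H | ∃ ψ : Polynomial K, ψ.Monic ∧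
    D ≤ ψ.natDegree ∧ (3 * L.length + 5 + 11) * ψ.natDegree <
      finrank K (LinearMap.ker (Polynomial.aeval (wordEnd (FreeGroup.mk L) g) ψ))}) ?_
  intro g hg
  by_contra hcon
  apply hg
  obtain ⟨Ψ, hΨ, hΨD, hΨle, hΨ1, hdvd⟩ := exists_monic_dvd (K := K) D
  rw [← Nat.card_eq_fintype_card] at hΨle
  rw [map_mul, map_mul, map_inv]
  refine (card_centralizer_le _ _).trans (Nat.pow_le_pow_right Nat.card_pos ?_)
  exact (finrank_commutant_le _ _ D hD Ψ hΨ hΨD hdvd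
    fun ψ h1 h2 => not_lt.1 fun h3 => hcon ⟨ψ, h1, h2, h3⟩).trans (he _ ⟨hΨle, hΨ1⟩)

end LinearGroups

/-! ### Combining the bounds over small and large fields -/

open Module in
/-- Word values in large linear groups with large orbits have small centralizers. -/
theorem exists_forall_card_large_centralizer_lt {d : ℕ} {w : FreeGroup (Fin d)} (hw : w ≠ 1) :
    ∃ M : ℕ, ∀ ε : ℝ, 0 < ε → ∃ N : ℕ, ∀ (K V : Type) [Field K] [AddCommGroup V] [Module K V]
      [Finite K] [Finite V] (H : Subgroup (V ≃ₗ[K] V)), HasLargeOrbits H 5 → N ≤ Nat.card H →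
      (Nat.card {g : Fin d → H // ¬ Nat.card (Subgroup.centralizer
        ({FreeGroup.lift g w} : Set H)) ≤ Nat.card K ^ (M * finrank K V)} : ℝ) <
      ε * Nat.card (Fin d → H) := by
  obtain ⟨u, L, hL, hred, rfl⟩ := exists_conj_isCyclicallyReduced hw
  set m := 3 * L.length + 16 with hm
  refine ⟨2 * m, fun ε hε => ?_⟩
  obtain ⟨K₀, hK₀⟩ := exists_nat_gt (1 / ε)
  obtain ⟨D, hD⟩ : ∃ D : ℕ, 1 / ε < 2 ^ D := pow_unbounded_of_one_lt _ one_lt_two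
  have hD' : 1 / ε < 2 ^ (D + 1) :=
    hD.trans_le (pow_le_pow_right₀ one_le_two (by omega))
  set D₁ := D + 1 with hD₁
  set n₁ := m * D₁ * (D₁ + D₁ * (D₁ * K₀ ^ D₁)) with hn₁
  refine ⟨K₀ ^ (n₁ * n₁) + 1, ?_⟩
  intro K V _ _ _ _ _ H hH hN
  have : FiniteDimensional K V := Module.Finite.of_finite
  have hκ : 1 < Nat.card K := Finite.one_lt_card
  set n := finrank K V with hn
  have hX : (0 : ℝ) < Nat.card (Fin d → H) := by exact_mod_cast Nat.card_pos
  have hfinish : ∀ (b E : ℕ), b * Nat.card K ^ E ≤ Nat.card (Fin d → H) →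
      1 / ε < (Nat.card K : ℝ) ^ E → (b : ℝ) < ε * Nat.card (Fin d → H) := by
    intro b E h1 h2
    have h1' : (b : ℝ) * (Nat.card K : ℝ) ^ E ≤ Nat.card (Fin d → H) := by exact_mod_cast h1
    rw [div_lt_iff₀ hε] at h2
    by_contra! hcon
    have h3 : (Nat.card (Fin d → H) : ℝ) * 1 <
        Nat.card (Fin d → H) * ((Nat.card K : ℝ) ^ E * ε) := mul_lt_mul_of_pos_left h2 hX
    have h4 : ε * Nat.card (Fin d → H) * (Nat.card K : ℝ) ^ E ≤ b * (Nat.card K : ℝ) ^ E :=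
      mul_le_mul_of_nonneg_right hcon (by positivity)
    linarith
  rcases Nat.lt_or_ge (Nat.card K) K₀ with hlt | hge
  -- Bounded field: H is large, so n is large, and n₁ was chosen so that the error term of the
  -- commutant bound is at most m * n.
  · have hnn : n₁ ≤ n := by
      by_contra! hcon
      have h1 := card_subgroup_le H
      rw [← hn] at h1
      have h2 : Nat.card K ^ (n * n) ≤ K₀ ^ (n₁ * n₁) :=
        (Nat.pow_le_pow_left hlt.le _).trans
          (Nat.pow_le_pow_right (by omega) (Nat.mul_le_mul hcon.le hcon.le))
      omega
    refine hfinish _ D₁ (card_large_centralizer_mul_le hH u hL hred D₁ (2 * m * n) (by omega) ?_) ?_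
    · rintro Ψ ⟨h1, -⟩
      have h2 : m * D₁ * (m * Ψ) ≤ m * n := by
        calc _ = m * (m * D₁ * Ψ) := by ring
          _ ≤ m * (m * D₁ * (D₁ + D₁ * (D₁ * Nat.card K ^ D₁))) := by gcongr
          _ ≤ m * n₁ := by rw [hn₁]; gcongr
          _ ≤ m * n := Nat.mul_le_mul_left _ hnn
      rw [← hm, ← hn, mul_assoc 2, two_mul]
      exact Nat.add_le_add_left h2 _
    · exact hD'.trans_le (pow_le_pow_left₀ (by norm_num) (by exact_mod_cast hκ) _)
  -- Large field: D = 1 already gives exceptional probability at most 1/|K| < ε. The error term m *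
  -- m is at most m * n once m ≤ n; for n < m even |H| ≤ |K|^(n * n) is small enough.
  · rcases Nat.lt_or_ge n m with hnm | hnm
    · have : IsEmpty {g : Fin d → H // ¬ Nat.card (Subgroup.centralizer
          ({FreeGroup.lift g (u * FreeGroup.mk L * u⁻¹)} : Set H)) ≤
            Nat.card K ^ (2 * m * n)} := by
        refine ⟨fun g => g.2 ?_⟩
        refine (Subgroup.card_le_card_group _).trans ((card_subgroup_le H).trans ?_)
        refine Nat.pow_le_pow_right (by omega) (Nat.mul_le_mul_right _ (by omega))
      rw [Nat.card_of_isEmpty, Nat.cast_zero]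
      positivity
    · refine hfinish _ 1 (card_large_centralizer_mul_le hH u hL hred 1 (2 * m * n) one_pos ?_) ?_
      · rintro Ψ ⟨-, h1⟩
        have h2 : m * 1 * (m * Ψ) ≤ m * n := by
          calc _ ≤ m * 1 * (m * 1) := by gcongr; exact h1 rfl
            _ ≤ m * n := by rw [mul_one]; exact Nat.mul_le_mul_left _ hnm
        rw [← hm, ← hn, mul_assoc 2, two_mul]
        exact Nat.add_le_add_left h2 _
      · rw [pow_one]
        exact hK₀.trans_le (by exact_mod_cast hge)

/-! ### Passage to quotients -/

section Quotients

theorem natCard_fin_fun (d : ℕ) (X : Type*) : Nat.card (Fin d → X) = Nat.card X ^ d := by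
  rw [Nat.card_fun, Nat.card_eq_fintype_card (α := Fin d), Fintype.card_fin]

variable {H G : Type*} [Group H] [Group G] {π : H →* G}

theorem lift_comp_apply {d : ℕ} (h : Fin d → H) (w : FreeGroup (Fin d)) :
    FreeGroup.lift (π ∘ h) w = π (FreeGroup.lift h w) := by
  have : FreeGroup.lift (π ∘ h) = π.comp (FreeGroup.lift h) := by
    ext i
    simp
  rw [this, MonoidHom.comp_apply]

variable [Finite H]

theorem card_mul_card_ker_le_of_mapsTo (hπ : Function.Surjective π) {d : ℕ}
    (P : (Fin d → G) → Prop) :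
    Nat.card {g // P g} * Nat.card π.ker ^ d ≤ Nat.card {h : Fin d → H // P (π ∘ h)} := by
  have : Nat.card π.ker ^ d = Nat.card (Fin d → π.ker) := (natCard_fin_fun d _).symm
  rw [this, ← Nat.card_prod]
  let s := Function.surjInv hπ
  have hs : ∀ x, π (s x) = x := Function.surjInv_eq hπ
  have hval : ∀ (g : Fin d → G) (z : Fin d → π.ker), (π ∘ fun i => s (g i) * z i) = g := by
    intro g z
    funext i
    rw [Function.comp_apply, map_mul, hs, MonoidHom.mem_ker.1 (z i).2, mul_one]
  refine Nat.card_le_card_of_injective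
    (fun p => ⟨fun i => s (p.1.1 i) * p.2 i, by rw [hval]; exact p.1.2⟩) ?_
  rintro ⟨⟨g, hg⟩, z⟩ ⟨⟨g', hg'⟩, z'⟩ h
  have h := Subtype.mk.inj h
  have hgg : g = g' := by rw [← hval g z, ← hval g' z']; exact congrArg (π ∘ ·) h
  subst hgg
  refine Prod.ext rfl (funext fun i => Subtype.ext ?_)
  exact mul_left_cancel (congrFun h i)

/-- On the preimage of the centralizer of π x, the map h ↦ h x h⁻¹ x⁻¹ takes values in the kernel,
and each non-empty fibre fits in a coset of the centralizer of x. The preimage has at least |ker π|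
elements for each element of the centralizer of π x. -/
theorem card_centralizer_map_le (hπ : Function.Surjective π) (x : H) :
    Nat.card (Subgroup.centralizer ({π x} : Set G)) ≤
      Nat.card (Subgroup.centralizer ({x} : Set H)) := by
  have h1 := card_mul_card_ker_le_of_mapsTo hπ (d := 1)
    (fun g => g 0 ∈ Subgroup.centralizer ({π x} : Set G))
  have e1 : Nat.card {g : Fin 1 → G // g 0 ∈ Subgroup.centralizer ({π x} : Set G)} =
      Nat.card (Subgroup.centralizer ({π x} : Set G)) :=
    Nat.card_congr ((Equiv.funUnique (Fin 1) G).subtypeEquiv fun g => Iff.rfl)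
  have e2 : Nat.card {h : Fin 1 → H //
      (π ∘ h) 0 ∈ Subgroup.centralizer ({π x} : Set G)} =
      {h : H | π h ∈ Subgroup.centralizer ({π x} : Set G)}.ncard :=
    Nat.card_congr ((Equiv.funUnique (Fin 1) H).subtypeEquiv fun g => Iff.rfl)
  rw [e1, e2, pow_one] at h1
  have h2 : {h : H | π h ∈ Subgroup.centralizer ({π x} : Set G)}.ncard ≤
      Nat.card (Subgroup.centralizer ({x} : Set H)) * (π.ker : Set H).ncard := by
    refine ncard_le_mul_ncard_of_mapsTo (fun h => h * x * h⁻¹ * x⁻¹) _ _ _ ?_ ?_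
    · intro h hh
      have hh := Subgroup.mem_centralizer_singleton_iff.1 hh
      change h * x * h⁻¹ * x⁻¹ ∈ π.ker
      rw [MonoidHom.mem_ker]
      simp only [map_mul, map_inv, hh]
      group
    · intro y
      rcases Set.eq_empty_or_nonempty {h | h ∈ {h : H | π h ∈
        Subgroup.centralizer ({π x} : Set G)} ∧ h * x * h⁻¹ * x⁻¹ = y} with h0 | ⟨t, -, ht⟩
      · rw [h0, Set.ncard_empty]
        exact Nat.zero_le _
      · rw [← Nat.card_coe_set_eq]
        refine Nat.card_le_card_of_injective (fun h => ⟨t⁻¹ * h.1, ?_⟩) ?_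
        · rw [Subgroup.mem_centralizer_singleton_iff]
          have h3 : h.1 * x * h.1⁻¹ = t * x * t⁻¹ := mul_right_cancel (h.2.2.trans ht.symm)
          have h4 : h.1 * x = t * x * t⁻¹ * h.1 := by rw [← h3]; group
          rw [mul_assoc, h4]
          group
        · intro h h' he
          exact Subtype.ext (mul_left_cancel (Subtype.mk.inj he))
  have h3 : (π.ker : Set H).ncard = Nat.card π.ker := rfl
  rw [h3] at h2
  exact Nat.le_of_mul_le_mul_right (h1.trans h2) Nat.card_pos

end Quotients

end ClassicalGroups

/-! ### The theorem for classical groups -/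

theorem mainTheorem7 {d : ℕ} (w : FreeGroup (Fin d)) (hw : w ≠ 1) :
    ∃ c : ℝ, ∀ ε : ℝ, 0 < ε → ∃ N : ℕ, ∀ (q r : ℕ) (G : Type*) [Group G],
      1 ≤ r → ClassicalGroups.IsClassicalGroup q r G → N ≤ Nat.card G →
        |ClassicalGroups.wordProb w G (fun x =>
            (Nat.card (Subgroup.centralizer ({x} : Set G)) : ℝ) ≤ (q : ℝ) ^ (c * (r : ℝ))) - 1|
          < ε := by
  obtain ⟨M, hM⟩ := ClassicalGroups.exists_forall_card_large_centralizer_lt hw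
  refine ⟨(6 * M : ℕ), fun ε hε => ?_⟩
  obtain ⟨N, hN⟩ := hM ε hε
  refine ⟨N, ?_⟩
  rintro q r G _ hr ⟨K, _, _, n, H, π, htype, hπ, -⟩ hG
  have : Finite G := Finite.of_surjective π hπ
  have hHG : Nat.card G ≤ Nat.card H := Nat.card_le_card_of_surjective π hπ
  have hbad := hN K (Fin n → K) H (ClassicalGroups.hasLargeOrbits_of_type htype) (hG.trans hHG)
  have hpow := ClassicalGroups.card_pow_finrank_le_of_type hr htype M
  have hq : (q : ℝ) ^ (((6 * M : ℕ) : ℝ) * (r : ℝ)) = ((q ^ (6 * M * r) : ℕ) : ℝ) := by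
    rw [← Nat.cast_mul, Real.rpow_natCast, Nat.cast_pow]
  simp only [ClassicalGroups.wordProb, hq, Nat.cast_le]
  set P : (Fin d → G) → Prop := fun g =>
    Nat.card (Subgroup.centralizer ({FreeGroup.lift g w} : Set G)) ≤ q ^ (6 * M * r) with hP
  have hsplit : Nat.card {g // P g} + Nat.card {g // ¬ P g} = Nat.card G ^ d := by
    have h1 : Nat.card (Fin d → G) = Nat.card G ^ d := ClassicalGroups.natCard_fin_fun d G
    classical
    rw [← h1, ← Nat.card_sum]
    exact Nat.card_congr (Equiv.sumCompl P)
  -- Each exceptional tuple in G lifts to |ker π|^d tuples in H, all exceptional there, so the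
  -- exceptional proportion in G is at most the one in H.
  have hker := ClassicalGroups.card_mul_card_ker_le_of_mapsTo hπ fun g => ¬ P g
  have hmono : Nat.card {h : Fin d → H // ¬ P (π ∘ h)} ≤
      Nat.card {g : Fin d → H // ¬ Nat.card (Subgroup.centralizer
        ({FreeGroup.lift g w} : Set H)) ≤ Nat.card K ^ (M * Module.finrank K (Fin n → K))} := by
    refine Nat.card_mono (Set.toFinite {g : Fin d → H | ¬ Nat.card (Subgroup.centralizer
        ({FreeGroup.lift g w} : Set H)) ≤ Nat.card K ^ (M * Module.finrank K (Fin n → K))}) ?_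
    intro h hh hle
    apply hh
    rw [hP]
    simp only [ClassicalGroups.lift_comp_apply]
    exact (ClassicalGroups.card_centralizer_map_le hπ _).trans (hle.trans hpow)
  have hcard : Nat.card (Fin d → H) = Nat.card G ^ d * Nat.card π.ker ^ d := by
    have h1 : Nat.card (Fin d → H) = Nat.card H ^ d := ClassicalGroups.natCard_fin_fun d H
    have h2 : Nat.card H = Nat.card G * Nat.card π.ker := by
      rw [Subgroup.card_eq_card_quotient_mul_card_subgroup π.ker,
        Nat.card_congr (QuotientGroup.quotientKerEquivOfSurjective π hπ).toEquiv]
    rw [h1, h2, mul_pow]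
  have hkpos : (0 : ℝ) < (Nat.card π.ker : ℝ) ^ d := by
    have : 0 < Nat.card π.ker := Nat.card_pos
    positivity
  have hGpos : (0 : ℝ) < (Nat.card G : ℝ) ^ d := by
    have : 0 < Nat.card G := Nat.card_pos
    positivity
  have hfinal : (Nat.card {g // ¬ P g} : ℝ) < ε * (Nat.card G : ℝ) ^ d := by
    refine lt_of_mul_lt_mul_right (?_ : _ * (Nat.card π.ker : ℝ) ^ d < _) hkpos.le
    calc (Nat.card {g // ¬ P g} : ℝ) * (Nat.card π.ker : ℝ) ^ d ≤ _ := by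
          exact_mod_cast hker.trans hmono
      _ < _ := hbad
      _ = _ := by rw [hcard]; push_cast; ring
  have hsplit' : (Nat.card {g // P g} : ℝ) + (Nat.card {g // ¬ P g} : ℝ) =
      (Nat.card G : ℝ) ^ d := by exact_mod_cast hsplit
  have heq : (Nat.card {g // P g} : ℝ) / (Nat.card G : ℝ) ^ d - 1 =
      -((Nat.card {g // ¬ P g} : ℝ) / (Nat.card G : ℝ) ^ d) := by
    rw [eq_sub_of_add_eq hsplit', sub_div, div_self hGpos.ne']
    ring
  rw [heq, abs_neg, abs_of_nonneg (by positivity), div_lt_iff₀ hGpos]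
  exact hfinal
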